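/- Let $g$ be a natural number and let $A=(a_{ij})$ be a $g\times 5$ matrix with real entries. If the tropical rank of $A$ is $3$, then the Kapranov rank of $A$ is also $3$. Here the following definitions are used. A real $r\times r$ matrix $(b_{ij})$ is tropically singular if the minimum $\min_{\sigma\in S_r}\{b_{1,\sigma(1)}+\dots+b_{r,\sigma(r)}\}$ is attained by at least two permutations $\sigma$. The tropical rank of $A$ is the largest $r$ such that $A$ has an $r\times r$ minor that is not tropically singular. Let $\tilde K$ be the field of Puiseux series with real exponents, that is, of series $c_1\tau^{a_1}+c_2\tau^{a_2}+\cdots$ with $c_i\in\mathbf C$ and real exponents $a_1<a_2<\cdots$, finite in number or tending to infinity. Let $\mathrm{ord}$ send a nonzero series to its smallest exponent, and a vector of nonzero series to the vector of the orders of its entries. For an ideal $I\subseteq\tilde K[x_1,\dots,x_d]$, its tropical variety is the set of all $\mathrm{ord}(x)\in\mathbf R^d$, where $x$ runs over the points of $(\tilde K\setminus\{0\})^d$ with $f(x)=0$ for all $f\in I$. If $I$ is generated by homogeneous linear forms, this set is called a tropical linear space, of dimension $r$ if the linear subspace $\{x\in\tilde K^d : f(x)=0\ \forall f\in I\}$ has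 dimension $r$ over $\tilde K$. The Kapranov rank of $A$ is the smallest $r$ such that some tropical linear space of dimension $r$ in $\mathbf R^g$ contains all columns of $A$. -/

import Mathlib

noncomputable section

/-! ### Tropical determinant and tropical rank -/

/-- The tropical weight `a_{1,σ(1)} ⊙ ⋯ ⊙ a_{r,σ(r)}` of a permutation `σ`. -/
def tropWeight {r : ℕ} (A : Matrix (Fin r) (Fin r) ℝ) (σ : Equiv.Perm (Fin r)) : ℝ :=
  ∑ i, A i (σ i)

/-- The tropical determinant: the minimum of the weights of all permutations. -/
def tropDet {r : ℕ} (A : Matrix (Fin r) (Fin r) ℝ) : ℝ :=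
  Finset.univ.inf' Finset.univ_nonempty (tropWeight A)

/-- `A` is tropically singular if the minimum in `tropDet A` is attained at least twice. -/
def TropSingular {r : ℕ} (A : Matrix (Fin r) (Fin r) ℝ) : Prop :=
  ∃ σ ρ : Equiv.Perm (Fin r), σ ≠ ρ ∧ tropWeight A σ = tropDet A ∧ tropWeight A ρ = tropDet A

/-- The largest `r` such that some `r × r` minor of `A` is tropically nonsingular. A minor is
given by a choice of `r` distinct rows and `r` distinct columns; their order does not affect
singularity. -/
def tropicalRank {m n : ℕ} (A : Matrix (Fin m) (Fin n) ℝ) : ℕ :=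
  sSup {r : ℕ | ∃ (f : Fin r ↪ Fin m) (e : Fin r ↪ Fin n), ¬ TropSingular (A.submatrix f e)}

/-! ### Puiseux series with real exponents -/

/-- A Hahn series has left-finite support if it has finitely many exponents below every bound,
that is, if it is a finite sum or an infinite series `c₁ τ^a₁ + c₂ τ^a₂ + ⋯` with
`a₁ < a₂ < ⋯` tending to infinity. -/
def LeftFinite (x : HahnSeries ℝ ℂ) : Prop :=
  ∀ c : ℝ, (x.support ∩ Set.Iio c).Finite

theorem LeftFinite.mul {x y : HahnSeries ℝ ℂ} (hx : LeftFinite x) (hy : LeftFinite y) :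
    LeftFinite (x * y) := by
  intro c
  refine (Set.Finite.image2 (· + ·) (hx (c - y.order)) (hy (c - x.order))).subset ?_
  rintro b ⟨hb, hbc⟩
  obtain ⟨s, hs, t, ht, rfl⟩ := Set.mem_add.1 (HahnSeries.support_mul_subset hb)
  have h1 := HahnSeries.order_le_of_coeff_ne_zero hs
  have h2 := HahnSeries.order_le_of_coeff_ne_zero ht
  simp only [Set.mem_Iio] at hbc
  exact ⟨s, ⟨hs, by simp only [Set.mem_Iio]; linarith⟩, t,
    ⟨ht, by simp only [Set.mem_Iio]; linarith⟩, rfl⟩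

theorem LeftFinite.inv {x : HahnSeries ℝ ℂ} (hx : LeftFinite x) : LeftFinite x⁻¹ := by
  rcases eq_or_ne x 0 with rfl | hx0
  · simpa using hx
  set y := x⁻¹ with hy
  have hy0 : y ≠ 0 := inv_ne_zero hx0
  have hxy : x * y = 1 := mul_inv_cancel₀ hx0
  have hord : x.order + y.order = 0 := by
    rw [← HahnSeries.order_mul hx0 hy0, hxy, HahnSeries.order_one]
  set a := x.order with ha
  -- a positive lower bound for the gap between the first exponent and all others
  obtain ⟨ε, hε, hgap⟩ : ∃ ε : ℝ, 0 < ε ∧ ∀ s ∈ x.support, s ≠ a → a + ε ≤ s := by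
    have hfin : (x.support ∩ Set.Iio (a + 1) ∩ {s | s ≠ a}).Finite :=
      (hx (a + 1)).subset Set.inter_subset_left
    rcases (x.support ∩ Set.Iio (a + 1) ∩ {s | s ≠ a}).eq_empty_or_nonempty with he | hne
    · refine ⟨1, one_pos, fun s hs hsa => ?_⟩
      by_contra hlt
      have : s ∈ x.support ∩ Set.Iio (a + 1) ∩ {s | s ≠ a} := ⟨⟨hs, not_le.1 hlt⟩, hsa⟩
      rw [he] at this
      exact this
    · obtain ⟨m, hm, hmin⟩ := Set.exists_min_image _ id hfin hne
      have ham : a < m :=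
        lt_of_le_of_ne (HahnSeries.order_le_of_coeff_ne_zero hm.1.1) (Ne.symm hm.2)
      refine ⟨m - a, sub_pos.2 ham, fun s hs hsa => ?_⟩
      by_cases h1 : s < a + 1
      · have := hmin s ⟨⟨hs, h1⟩, hsa⟩
        simp only [id] at this
        linarith
      · have h2 : m < a + 1 := hm.1.2
        linarith
  -- every exponent of `y` but the first is a smaller exponent plus a gap of `x`
  have hstep : ∀ b ∈ y.support, b ≠ -a →
      ∃ t ∈ y.support, ∃ s ∈ x.support, s ≠ a ∧ b = t + (s - a) := by
    intro b hb hba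
    by_contra! hcon
    have hco : (x * y).coeff (a + b) = x.coeff a * y.coeff b := by
      rw [HahnSeries.coeff_mul]
      apply Finset.sum_eq_single (a, b)
      · rintro ⟨s, t⟩ hst hne
        rw [Finset.mem_antidiagonal] at hst
        obtain ⟨hs, ht, hsum⟩ := hst
        simp only at hs ht hsum
        exfalso
        rcases eq_or_ne s a with rfl | hsa
        · exact hne (by rw [add_left_cancel hsum])
        · exact hcon t ht s hs hsa (by linarith)
      · intro hnot
        rw [Finset.mem_antidiagonal] at hnot
        exact absurd ⟨HahnSeries.coeff_order_eq_zero.not.2 hx0, hb, rfl⟩ hnot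
    have h0 : (x * y).coeff (a + b) = 0 := by
      rw [hxy, HahnSeries.coeff_one, if_neg]
      intro h
      exact hba (by linarith)
    rw [h0] at hco
    exact mul_ne_zero (HahnSeries.coeff_order_eq_zero.not.2 hx0) hb hco.symm
  have key : ∀ n : ℕ, (y.support ∩ Set.Iio (-a + n * ε)).Finite := by
    intro n
    induction n with
    | zero =>
      convert Set.finite_empty
      ext b
      simp only [Nat.cast_zero, zero_mul, add_zero, Set.mem_inter_iff, Set.mem_Iio,
        Set.mem_empty_iff_false, iff_false, not_and, not_lt]
      intro hb
      have := HahnSeries.order_le_of_coeff_ne_zero hb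
      linarith
    | succ n ih =>
      refine ((Set.Finite.image2 (fun t s => t + (s - a)) ih
        (hx (a + (n + 1 : ℕ) * ε))).union (Set.finite_singleton (-a))).subset ?_
      rintro b ⟨hb, hbn⟩
      simp only [Set.mem_Iio] at hbn
      rcases eq_or_ne b (-a) with rfl | hba
      · exact Or.inr rfl
      · obtain ⟨t, ht, s, hs, hsa, rfl⟩ := hstep b hb hba
        have h1 := HahnSeries.order_le_of_coeff_ne_zero ht
        have h2 := hgap s hs hsa
        push_cast at hbn
        refine Or.inl ⟨t, ⟨ht, ?_⟩, s, ⟨hs, ?_⟩, rfl⟩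
        · simp only [Set.mem_Iio]; linarith
        · simp only [Set.mem_Iio]; push_cast; linarith
  intro c
  obtain ⟨n, hn⟩ := exists_nat_gt ((c + a) / ε)
  rw [div_lt_iff₀ hε] at hn
  exact (key n).subset fun b hb => ⟨hb.1, lt_trans (Set.mem_Iio.1 hb.2) (by linarith)⟩

/-- The field of Puiseux series `c₁ τ^a₁ + c₂ τ^a₂ + ⋯` with complex coefficients and real
exponents `a₁ < a₂ < ⋯` (finitely many, or tending to infinity). -/
def RealPuiseux : Subfield (HahnSeries ℝ ℂ) where
  carrier := {x | LeftFinite x}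
  zero_mem' := fun c => by simp
  one_mem' := fun c => by simp [Set.toFinite]
  add_mem' := fun {x y} hx hy c => ((hx c).union (hy c)).subset fun b hb =>
    (HahnSeries.support_add_subset x y hb.1).imp (fun h => ⟨h, hb.2⟩) (fun h => ⟨h, hb.2⟩)
  neg_mem' := fun {x} hx c => by simpa using hx c
  mul_mem' := fun hx hy => LeftFinite.mul hx hy
  inv_mem' := fun x hx => LeftFinite.inv hx

/-- The order of a nonzero series: its smallest exponent. (The value at `0` is irrelevant.) -/
def RealPuiseux.ord (x : RealPuiseux) : ℝ := (x : HahnSeries ℝ ℂ).order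

/-! ### Tropical linear spaces and Kapranov rank -/

/-- The zero set of an ideal in affine space. -/
def affineZeros {d : ℕ} (I : Ideal (MvPolynomial (Fin d) RealPuiseux)) :
    Set (Fin d → RealPuiseux) :=
  {x | ∀ f ∈ I, MvPolynomial.eval x f = 0}

/-- The zero set of an ideal in the torus: the zeros with all coordinates nonzero. -/
def torusZeros {d : ℕ} (I : Ideal (MvPolynomial (Fin d) RealPuiseux)) :
    Set (Fin d → RealPuiseux) :=
  {x | x ∈ affineZeros I ∧ ∀ i, x i ≠ 0}

/-- The tropical variety of an ideal: the coordinatewise orders of its zeros in the torus. -/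
def tropicalVariety {d : ℕ} (I : Ideal (MvPolynomial (Fin d) RealPuiseux)) :
    Set (Fin d → ℝ) :=
  (fun x i => RealPuiseux.ord (x i)) '' torusZeros I

/-- An ideal is linear if it is generated by (homogeneous) linear forms. -/
def IsLinearIdeal {d : ℕ} (I : Ideal (MvPolynomial (Fin d) RealPuiseux)) : Prop :=
  ∃ S : Set (MvPolynomial (Fin d) RealPuiseux),
    (∀ f ∈ S, f.IsHomogeneous 1) ∧ I = Ideal.span S

/-- `T` is a tropical linear space of dimension `r`: the tropical variety of a linear ideal whose
zero set, a linear subspace of affine space, has dimension `r`. (`Set.finrank` is the dimension of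
the linear span of a set; the zero set of a linear ideal is its own span.) -/
def IsTropicalLinearSpace {d : ℕ} (r : ℕ) (T : Set (Fin d → ℝ)) : Prop :=
  ∃ I : Ideal (MvPolynomial (Fin d) RealPuiseux),
    IsLinearIdeal I ∧ Set.finrank RealPuiseux (affineZeros I) = r ∧ T = tropicalVariety I

/-- The smallest dimension of a tropical linear space that contains the columns of `A`. -/
def kapranovRank {m n : ℕ} (A : Matrix (Fin m) (Fin n) ℝ) : ℕ :=
  sInf {r : ℕ | ∃ T : Set (Fin m → ℝ), IsTropicalLinearSpace r T ∧ ∀ j, (fun i => A i j) ∈ T}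

end

/-! Over the series field, a lift of `A` of corank two has a two-dimensional kernel, which
tropicalizes to a tropical line inside `tropKernel A`. The proof goes the other way: find a tropical
line in the tropical kernel, realize it by a plane spanned by two vectors `p`, `q`, and lift each
row of `A` to a vector orthogonal to both.

Rays exist because all 4×4 minors are singular: after deletion of any column `k` the remaining four
columns are tropically dependent (`exists_attainedTwice_of_not_isTriangular`), which gives a point
of the kernel with coordinate `k` at infinity (`exists_isRay`).

The five rays have to be fitted into one line, and this is where five columns matter. The kernel is
closed under tropical combinations, so it contains the tropical segment between any two of its
points. If the coordinatewise differences of the points are distinct, a leaf grows at each bend of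
the segment and the result is a line (`hasPencil_of_injective_sub`). A single coincidence leaves one
leaf with two indices, which a further ray splits (`hasPencil_of_four_leaves`). If no two rays
produce a line in this way, they are so similar that all five meet at one point
(`hasPencil_of_exists_isRay`).

For the lift, each row satisfies the tropical incidence condition with every circuit `p i * q k - p
k * q i`. Vectors supported on three indices, orthogonal to `p` and `q`, then have the required
orders one coordinate at a time (`exists_relation`), and a generic complex combination has them all.
The lift has rank at most 5 - 2 = 3. The reverse inequality, for this and any other space, holds
because a tropically nonsingular minor lifts to a nonsingular one. -/

/-- The minimum of `β` is attained at least twice. -/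
def AttainedTwice {ι : Type*} (β : ι → ℝ) : Prop :=
  ∃ i j, i ≠ j ∧ ∀ l, β i ≤ β l ∧ β j ≤ β l

/-- The minimum of `β` over the indices different from `k` is attained at least twice. -/
def AttainedTwiceOff {ι : Type*} (k : ι) (β : ι → ℝ) : Prop :=
  ∃ i j, i ≠ j ∧ i ≠ k ∧ j ≠ k ∧ ∀ l, l ≠ k → β i ≤ β l ∧ β j ≤ β l

/-- The intersection of the tropical hyperplanes defined by the rows of `A`. -/
def tropKernel {ρ ι : Type*} (A : ρ → ι → ℝ) : Set (ι → ℝ) :=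
  {v | ∀ r, AttainedTwice fun i => v i + A r i}

/-- Increasing the coordinate `k` of `v` to infinity gives a point in the tropical kernel. -/
def IsRay {ρ ι : Type*} (A : ρ → ι → ℝ) (v : ι → ℝ) (k : ι) : Prop :=
  ∀ r, AttainedTwiceOff k fun i => v i + A r i

/-- The coordinates in which `y - z` is minimal include exactly one of `k` and `f`. -/
def Separates {ι : Type*} (y z : ι → ℝ) (k f : ι) : Prop :=
  ∃ c, (∀ i, z i + c ≤ y i) ∧
    (y k = z k + c ∧ z f + c < y f ∨ y f = z f + c ∧ z k + c < y k)

/-! ### The tropical kernel and its rays -/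

section Kernel

variable {ρ ι : Type*} {A : ρ → ι → ℝ}

theorem add_const_mem_tropKernel {v : ι → ℝ} (hv : v ∈ tropKernel A) (c : ℝ) :
    (fun i => v i + c) ∈ tropKernel A := by
  intro r
  obtain ⟨i, j, hij, h⟩ := hv r
  exact ⟨i, j, hij, fun l => ⟨by linarith [(h l).1], by linarith [(h l).2]⟩⟩

/-- In each row, the point with the smaller minimum attains it at two indices, and the other point
cannot undercut it. -/
theorem min_mem_tropKernel {v w : ι → ℝ} (hv : v ∈ tropKernel A) (hw : w ∈ tropKernel A) :
    (fun i => min (v i) (w i)) ∈ tropKernel A := by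
  have key : ∀ {v w : ι → ℝ} (r : ρ) (i j k : ι), i ≠ j →
      (∀ l, v i + A r i ≤ v l + A r l ∧ v j + A r j ≤ v l + A r l) →
      (∀ l, w k + A r k ≤ w l + A r l) → v i + A r i ≤ w k + A r k →
      AttainedTwice fun i => min (v i) (w i) + A r i := by
    intro v w r i j k hij h h' hle
    refine ⟨i, j, hij, fun l => ?_⟩
    have h1 := h l
    have h2 := h' l
    have h3 := (h i).2
    have h4 := h' i
    simp only [← min_add_add_right]
    exact ⟨le_min ((min_le_left _ _).trans h1.1) ((min_le_left _ _).trans (by linarith)),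
      le_min ((min_le_left _ _).trans h1.2) ((min_le_left _ _).trans (by linarith))⟩
  intro r
  obtain ⟨i, j, hij, h⟩ := hv r
  obtain ⟨i', j', hij', h'⟩ := hw r
  rcases le_total (v i + A r i) (w i' + A r i') with hle | hle
  · exact key r i j i' hij h (fun l => (h' l).1) hle
  · simp only [min_comm (v _)]
    exact key r i' j' i hij' h' (fun l => (h l).1) hle

theorem min_add_mem_tropKernel {v w : ι → ℝ} (hv : v ∈ tropKernel A) (hw : w ∈ tropKernel A)
    (c : ℝ) : (fun i => min (v i) (w i + c)) ∈ tropKernel A :=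
  min_mem_tropKernel hv (add_const_mem_tropKernel hw c)

theorem IsRay.congr {v w : ι → ℝ} {k : ι} (hv : IsRay A v k) (c : ℝ)
    (h : ∀ i, i ≠ k → w i = v i + c) : IsRay A w k := by
  intro r
  obtain ⟨i, j, hij, hi, hj, hl⟩ := hv r
  refine ⟨i, j, hij, hi, hj, fun l hlk => ?_⟩
  simp only [h i hi, h j hj, h l hlk]
  exact ⟨by linarith [(hl l hlk).1], by linarith [(hl l hlk).2]⟩

/-- The condition off `k` can fail only in a row whose minimum at `z` is attained exactly at `k` and
one other index `f`. A point `y` that lies above a translate of `z` and touches it at only one of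
`k`, `f` would then attain its minimum in that row only once. -/
theorem isRay_of_separates {z : ι → ℝ} {k : ι} (hz : z ∈ tropKernel A)
    (h : ∀ f, f ≠ k → ∃ y ∈ tropKernel A, Separates y z k f) : IsRay A z k := by
  intro r
  have key : ∀ f, f ≠ k → (∀ l, z k + A r k ≤ z l + A r l ∧ z f + A r f ≤ z l + A r l) →
      AttainedTwiceOff k fun i => z i + A r i := by
    intro f hf hl
    by_cases hs : ∃ s, s ≠ k ∧ s ≠ f ∧ z s + A r s ≤ z k + A r k
    · obtain ⟨s, hsk, hsf, hs⟩ := hs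
      exact ⟨f, s, hsf.symm, hf, hsk, fun l _ => ⟨(hl l).2, by linarith [(hl l).1]⟩⟩
    · exfalso
      push Not at hs
      obtain ⟨y, hy, c, hc, hsep⟩ := h f hf
      obtain ⟨p, q, hpq, hm⟩ := hy r
      have hk := hl f
      have hf' := (hl k).2
      rcases hsep with ⟨h1, h2⟩ | ⟨h1, h2⟩
      · have hp : ∀ p, y p + A r p ≤ y k + A r k → p = k := by
          intro p hp
          by_contra hpk
          have := hc p
          by_cases hpf : p = f
          · subst hpf; linarith
          · linarith [hs p hpk hpf]
        exact hpq ((hp p (hm k).1).trans (hp q (hm k).2).symm)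
      · have hp : ∀ p, y p + A r p ≤ y f + A r f → p = f := by
          intro p hp
          by_contra hpf
          have := hc p
          by_cases hpk : p = k
          · subst hpk; linarith
          · linarith [hs p hpk hpf]
        exact hpq ((hp p (hm f).1).trans (hp q (hm f).2).symm)
  obtain ⟨i, j, hij, hl⟩ := hz r
  by_cases hik : i = k
  · subst hik
    exact key j hij.symm hl
  by_cases hjk : j = k
  · subst hjk
    exact key i hij fun l => (hl l).symm
  exact ⟨i, j, hij, hik, hjk, fun l _ => hl l⟩

theorem IsRay.eventually_update_mem [Finite ρ] [DecidableEq ι] {v : ι → ℝ} {k : ι}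
    (hv : IsRay A v k) : ∀ᶠ t in Filter.atTop, Function.update v k t ∈ tropKernel A := by
  have : ∀ᶠ t in Filter.atTop, ∀ r, AttainedTwice fun i => Function.update v k t i + A r i := by
    rw [Filter.eventually_all]
    intro r
    obtain ⟨i, j, hij, hi, hj, hl⟩ := hv r
    filter_upwards [Filter.eventually_ge_atTop (v i + A r i - A r k),
      Filter.eventually_ge_atTop (v j + A r j - A r k)] with t ht ht'
    refine ⟨i, j, hij, fun l => ?_⟩
    by_cases hlk : l = k
    · subst hlk
      simp [hi, hj]
      exact ⟨by linarith, by linarith⟩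
    · simpa [hi, hj, hlk] using hl l hlk
  exact this

end Kernel

/-! ### Singular minors and tropical dependence of columns -/

section Dependence

/-- The rows `f i`, shifted by `μ`, attain their minimum at `i`, and ties occur only with indices
of lower order: these rows form a square matrix with a unique optimal permutation. -/
def IsTriangular {ρ ι : Type*} (A : ρ → ι → ℝ) (μ : ι → ℝ) (f : ι → ρ) (o : ι → ℕ) : Prop :=
  ∀ i j, j ≠ i → μ i + A (f i) i < μ j + A (f i) j ∨
    μ i + A (f i) i = μ j + A (f i) j ∧ o j < o i

variable {ρ ι : Type*} {A : ρ → ι → ℝ}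

theorem IsTriangular.injective {μ : ι → ℝ} {f : ι → ρ} {o : ι → ℕ}
    (h : IsTriangular A μ f o) : Function.Injective f := by
  intro i j hij
  by_contra hne
  have h1 := h i j (Ne.symm hne)
  have h2 := h j i hne
  rw [hij] at h1
  rcases h1 with h1 | h1 <;> rcases h2 with h2 | h2
  · linarith
  · linarith [h2.1]
  · linarith [h1.1]
  · omega

/-- The shifts `μ` cancel in the sum over a permutation, so the identity is optimal. If `σ` tied
with it, then `o (σ i) ≤ o i` throughout with strict inequality at a moved index, although both
sides have the same sum. -/
theorem IsTriangular.sum_lt [Fintype ι] {μ : ι → ℝ} {f : ι → ρ} {o : ι → ℕ}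
    (h : IsTriangular A μ f o) {σ : Equiv.Perm ι} (hσ : σ ≠ 1) :
    ∑ i, A (f i) i < ∑ i, A (f i) (σ i) := by
  have hle : ∀ i, μ i + A (f i) i ≤ μ (σ i) + A (f i) (σ i) := by
    intro i
    by_cases hi : σ i = i
    · rw [hi]
    · rcases h i _ hi with h | h
      · exact h.le
      · exact h.1.le
  have hμ : ∑ i, μ (σ i) = ∑ i, μ i := Equiv.sum_comp σ μ
  have hsum : ∀ s : ι → ι, ∑ i, (μ (s i) + A (f i) (s i))
      = ∑ i, μ (s i) + ∑ i, A (f i) (s i) := fun s => Finset.sum_add_distrib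
  have h1 := hsum id
  have h2 := hsum σ
  simp only [id] at h1
  suffices hlt : ∃ i, μ i + A (f i) i < μ (σ i) + A (f i) (σ i) by
    obtain ⟨i, hi⟩ := hlt
    have := Finset.sum_lt_sum (fun i _ => hle i) ⟨i, Finset.mem_univ i, hi⟩
    linarith
  by_contra! hcon
  have ho : ∀ i, o (σ i) ≤ o i := by
    intro i
    by_cases hi : σ i = i
    · rw [hi]
    · rcases h i _ hi with h | h
      · exact absurd h (not_lt.2 (hcon i))
      · exact h.2.le
  obtain ⟨i, hi⟩ : ∃ i, σ i ≠ i := by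
    by_contra! hc
    exact hσ (Equiv.ext hc)
  have hlt : o (σ i) < o i := by
    rcases h i _ hi with h | h
    · exact absurd h (not_lt.2 (hcon i))
    · exact h.2
  have := Finset.sum_lt_sum (fun i _ => ho i) ⟨i, Finset.mem_univ i, hlt⟩
  rw [Equiv.sum_comp σ o] at this
  exact lt_irrefl _ this

theorem isClosed_attainedTwice [Finite ι] (a : ι → ℝ) :
    IsClosed {v : ι → ℝ | AttainedTwice fun i => v i + a i} := by
  have : {v : ι → ℝ | AttainedTwice fun i => v i + a i} =
      ⋃ i, ⋃ j, ⋃ (_ : i ≠ j), ⋂ l, {v | v i + a i ≤ v l + a l ∧ v j + a j ≤ v l + a l} := by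
    ext v
    simp [AttainedTwice]
  rw [this]
  refine isClosed_iUnion_of_finite fun i => isClosed_iUnion_of_finite fun j =>
    isClosed_iUnion_of_finite fun _ => isClosed_iInter fun l => ?_
  exact (isClosed_le (f := fun v : ι → ℝ => v i + a i) (g := fun v => v l + a l)
    (by fun_prop) (by fun_prop)).inter (isClosed_le (f := fun v : ι → ℝ => v j + a j)
    (g := fun v => v l + a l) (by fun_prop) (by fun_prop))

/-- A maximal set of indices with a partial triangular system is closed under the ties of all
rows. -/
theorem exists_closed_finset [Fintype ι] (μ : ι → ℝ) (a : ρ) (j₁ : ι)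
    (ha : ∀ i, i ≠ j₁ → μ j₁ + A a j₁ < μ i + A a i)
    (hA : ∀ f o, ¬ IsTriangular A μ f o) :
    ∃ B : Finset ι, j₁ ∈ B ∧ B ≠ Finset.univ ∧ ∀ (r : ρ) (i e : ι), i ≠ e →
      (∀ l, μ i + A r i ≤ μ l + A r l) → e ∉ B → μ e + A r e ≤ μ i + A r i →
      ∃ e', e' ≠ e ∧ e' ∉ B ∧ μ e' + A r e' ≤ μ i + A r i := by
  classical
  let U : Finset ι → Prop := fun B => j₁ ∈ B ∧ ∃ (f : ι → ρ) (o : ι → ℕ), ∀ i ∈ B, ∀ j, j ≠ i →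
    μ i + A (f i) i < μ j + A (f i) j ∨ μ i + A (f i) i = μ j + A (f i) j ∧ j ∈ B ∧ o j < o i
  have hU0 : U {j₁} := by
    refine ⟨Finset.mem_singleton_self _, fun _ => a, fun _ => 0, fun i hi j hj => ?_⟩
    rw [Finset.mem_singleton] at hi
    subst hi
    exact Or.inl (ha j hj)
  obtain ⟨B, hB, hmax⟩ := Finset.exists_max_image (Finset.univ.filter U) Finset.card
    ⟨{j₁}, by simpa using hU0⟩
  simp only [Finset.mem_filter, Finset.mem_univ, true_and] at hB hmax
  obtain ⟨hj, f, o, hfo⟩ := hB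
  refine ⟨B, hj, ?_, ?_⟩
  · rintro rfl
    exact hA f o fun i j hji => (hfo i (Finset.mem_univ _) j hji).imp_right fun h => ⟨h.1, h.2.2⟩
  · intro r i e hie hi he hle
    by_contra! hcon
    have hmin : ∀ l, μ e + A r e ≤ μ l + A r l := fun l => hle.trans (hi l)
    have hlt : ∀ e', e' ≠ e → e' ∉ B → μ e + A r e < μ e' + A r e' := fun e' h1 h2 =>
      hle.trans_lt (hcon e' h1 h2)
    -- Row `r` attains its minimum at `e` and ties only with indices of `B`, so it extends the
    -- triangular system to `e`, placed above all of `B` in the order.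
    have hU : U (insert e B) := by
      refine ⟨Finset.mem_insert_of_mem hj, Function.update f e r,
        Function.update o e (B.sup o + 1), ?_⟩
      intro i hi j hji
      rcases Finset.mem_insert.1 hi with rfl | hiB
      · simp only [Function.update_self]
        by_cases hjB : j ∈ B
        · rcases (hmin j).lt_or_eq with h | h
          · exact Or.inl h
          · refine Or.inr ⟨h, Finset.mem_insert_of_mem hjB, ?_⟩
            rw [Function.update_of_ne hji]
            exact Nat.lt_succ_of_le (Finset.le_sup hjB)
        · exact Or.inl (hlt j hji hjB)
      · have hie : i ≠ e := fun h => he (h ▸ hiB)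
        rw [Function.update_of_ne hie, Function.update_of_ne hie]
        rcases hfo i hiB j hji with h | ⟨h1, h2, h3⟩
        · exact Or.inl h
        · refine Or.inr ⟨h1, Finset.mem_insert_of_mem h2, ?_⟩
          rw [Function.update_of_ne (fun h : j = e => he (h ▸ h2))]
          exact h3
    have := hmax _ hU
    rw [Finset.card_insert_of_notMem he] at this
    omega

/-- Lowering all coordinates outside a closed set of indices preserves the tropical hyperplane
condition, for small steps. -/
theorem eventually_attainedTwice_sub [Finite ι] [DecidableEq ι] (B : Finset ι) (μ a : ι → ℝ)
    (h : AttainedTwice fun i => μ i + a i)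
    (hB : ∀ i e : ι, i ≠ e → (∀ l, μ i + a i ≤ μ l + a l) → e ∉ B → μ e + a e ≤ μ i + a i →
      ∃ e', e' ≠ e ∧ e' ∉ B ∧ μ e' + a e' ≤ μ i + a i) :
    ∀ᶠ ε : ℝ in nhdsWithin 0 (Set.Ioi 0),
      AttainedTwice fun i => (if i ∈ B then μ i else μ i - ε) + a i := by
  obtain ⟨i, j, hij, hl⟩ := h
  -- If the minimum is attained outside `B`, it is attained there twice, and both places drop by the
  -- same `ε`. Otherwise it is attained only inside `B`, and a small `ε` does not disturb it.
  by_cases he : ∃ e, e ∉ B ∧ μ e + a e ≤ μ i + a i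
  · obtain ⟨e, he, hle⟩ := he
    obtain ⟨e', hne, he', hle'⟩ : ∃ e', e' ≠ e ∧ e' ∉ B ∧ μ e' + a e' ≤ μ i + a i := by
      by_cases hie : i = e
      · subst hie
        obtain ⟨e', h1, h2, h3⟩ := hB j i hij.symm (fun l => (hl l).2) he (hl j).1
        exact ⟨e', h1, h2, h3.trans (hl i).2⟩
      · exact hB i e hie (fun l => (hl l).1) he hle
    filter_upwards [self_mem_nhdsWithin] with ε hε
    have hε : (0 : ℝ) < ε := hε
    refine ⟨e, e', hne.symm, fun l => ?_⟩
    have := (hl l).1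
    simp only [he, he', if_false]
    split_ifs <;> constructor <;> linarith
  · push Not at he
    have hev : ∀ᶠ ε : ℝ in nhdsWithin 0 (Set.Ioi 0), ∀ e, e ∉ B → μ i + a i + ε < μ e + a e := by
      rw [Filter.eventually_all]
      intro e
      by_cases heB : e ∈ B
      · simp [heB]
      · have h1 : Filter.Tendsto (fun ε : ℝ => μ i + a i + ε) (nhdsWithin 0 (Set.Ioi 0))
            (nhds (μ i + a i + 0)) :=
          ((continuous_const.add continuous_id).tendsto 0).mono_left nhdsWithin_le_nhds
        have h2 := h1.eventually_lt_const (by simpa using he e heB)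
        filter_upwards [h2] with ε hε _ using hε
    have hiB : i ∈ B := by
      by_contra h
      exact lt_irrefl _ (he i h)
    have hjB : j ∈ B := by
      by_contra h
      exact absurd (he j h) (not_lt.2 (hl i).2)
    filter_upwards [hev] with ε hε
    refine ⟨i, j, hij, fun l => ?_⟩
    simp only [hiB, hjB, if_true]
    have := hl l
    have h3 := (hl i).2
    split_ifs with hlB
    · exact this
    · have := hε l hlB
      constructor <;> linarith

/-- Rows are added one at a time. If row `a` cannot be added, its minimum stays at a single index
`j₁` while the other coordinates are lowered as far as the earlier rows allow. At a lowest position,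
the closed set of `exists_closed_finset` is proper, so the coordinates outside it can still be
lowered: a contradiction. -/
theorem exists_attainedTwice_of_not_isTriangular [Fintype ι] [Finite ρ] [Nonempty ι]
    (hA : ∀ μ f o, ¬ IsTriangular A μ f o) : (tropKernel A).Nonempty := by
  classical
  have := Fintype.ofFinite ρ
  suffices h : ∀ R : Finset ρ, ∃ μ : ι → ℝ, ∀ r ∈ R, AttainedTwice fun i => μ i + A r i by
    obtain ⟨μ, hμ⟩ := h Finset.univ
    exact ⟨μ, fun r => hμ r (Finset.mem_univ r)⟩
  intro R
  induction R using Finset.induction_on with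
  | empty => exact ⟨0, by simp⟩
  | insert a R ha ih =>
    obtain ⟨μ₀, hμ₀⟩ := ih
    by_contra hcon
    push Not at hcon
    obtain ⟨j₁, hj₁⟩ := Finite.exists_min fun i => μ₀ i + A a i
    -- The normalization at `j₁`, the lower bounds from row `a` and the bound on the sum make this
    -- set compact.
    let S : Set (ι → ℝ) := {μ | (∀ r ∈ R, AttainedTwice fun i => μ i + A r i) ∧ μ j₁ = 0 ∧
      (∀ i, A a j₁ - A a i ≤ μ i) ∧ ∑ i, μ i ≤ ∑ i, (μ₀ i - μ₀ j₁)}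
    have hne : S.Nonempty := by
      refine ⟨fun i => μ₀ i - μ₀ j₁, fun r hr => ?_, sub_self _, fun i => ?_, le_rfl⟩
      · obtain ⟨i, j, hij, h⟩ := hμ₀ r hr
        exact ⟨i, j, hij, fun l => ⟨by linarith [(h l).1], by linarith [(h l).2]⟩⟩
      · have := hj₁ i
        simp only at this ⊢
        linarith
    have hclosed : IsClosed S := by
      have h1 : IsClosed {μ : ι → ℝ | ∀ r ∈ R, AttainedTwice fun i => μ i + A r i} := by
        simp only [Set.ofPred_forall]
        exact isClosed_biInter fun r _ => isClosed_attainedTwice _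
      have h3 : IsClosed {μ : ι → ℝ | ∀ i, A a j₁ - A a i ≤ μ i} := by
        simp only [Set.ofPred_forall]
        exact isClosed_iInter fun i => isClosed_le (f := fun _ : ι → ℝ => A a j₁ - A a i)
          (g := fun μ => μ i) (by fun_prop) (by fun_prop)
      have h2 : IsClosed {μ : ι → ℝ | μ j₁ = 0} :=
        isClosed_eq (by fun_prop) (by fun_prop)
      have h4 : IsClosed {μ : ι → ℝ | ∑ i, μ i ≤ ∑ i, (μ₀ i - μ₀ j₁)} :=
        isClosed_le (by fun_prop) (by fun_prop)
      exact h1.inter (h2.inter (h3.inter h4))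
    have hbdd : S ⊆ Set.Icc (fun i => A a j₁ - A a i)
        (fun i => ∑ i, (μ₀ i - μ₀ j₁) - ∑ j ∈ Finset.univ.erase i, (A a j₁ - A a j)) := by
      rintro μ ⟨-, -, h3, h4⟩
      refine ⟨h3, fun i => ?_⟩
      have := Finset.add_sum_erase Finset.univ μ (Finset.mem_univ i)
      have h5 : ∑ j ∈ Finset.univ.erase i, (A a j₁ - A a j) ≤ ∑ j ∈ Finset.univ.erase i, μ j :=
        Finset.sum_le_sum fun j _ => h3 j
      simp only
      linarith
    have hcomp : IsCompact S := isCompact_Icc.of_isClosed_subset hclosed hbdd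
    obtain ⟨μ, ⟨hR, h0, hge, hsum⟩, hmin⟩ := hcomp.exists_isMinOn hne
      (f := fun μ : ι → ℝ => ∑ i, μ i) (by fun_prop)
    have hlt : ∀ i, i ≠ j₁ → μ j₁ + A a j₁ < μ i + A a i := by
      intro i hi
      by_contra hle
      obtain ⟨r, hr, hno⟩ := hcon μ
      rcases Finset.mem_insert.1 hr with rfl | hr
      · refine hno ⟨i, j₁, hi, fun l => ?_⟩
        have := hge l
        have := hge i
        constructor <;> linarith
      · exact hno (hR r hr)
    obtain ⟨B, hjB, hBu, hB⟩ := exists_closed_finset μ a j₁ hlt (hA μ)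
    have hev1 : ∀ᶠ ε : ℝ in nhdsWithin 0 (Set.Ioi 0), ∀ r ∈ R,
        AttainedTwice fun i => (if i ∈ B then μ i else μ i - ε) + A r i := by
      rw [Filter.eventually_all_finset]
      exact fun r hr => eventually_attainedTwice_sub B μ (A r) (hR r hr) (hB r)
    have hev2 : ∀ᶠ ε : ℝ in nhdsWithin 0 (Set.Ioi 0), ∀ i, i ≠ j₁ → A a j₁ + ε < μ i + A a i := by
      rw [Filter.eventually_all]
      intro i
      by_cases hi : i = j₁
      · simp [hi]
      · have h1 : Filter.Tendsto (fun ε : ℝ => A a j₁ + ε) (nhdsWithin 0 (Set.Ioi 0))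
            (nhds (A a j₁ + 0)) :=
          ((continuous_const.add continuous_id).tendsto 0).mono_left nhdsWithin_le_nhds
        have h2 := h1.eventually_lt_const (u := μ i + A a i) (by linarith [hlt i hi])
        filter_upwards [h2] with ε hε _ using hε
    obtain ⟨ε, ⟨h1, h2⟩, hε⟩ := ((hev1.and hev2).and self_mem_nhdsWithin).exists
    have hε : (0 : ℝ) < ε := hε
    obtain ⟨e, he⟩ : ∃ e, e ∉ B := by
      by_contra! h
      exact hBu (Finset.eq_univ_iff_forall.2 h)
    have hless : ∑ i, (if i ∈ B then μ i else μ i - ε) < ∑ i, μ i := by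
      refine Finset.sum_lt_sum (fun i _ => ?_) ⟨e, Finset.mem_univ e, ?_⟩
      · split_ifs <;> linarith
      · simp only [he, if_false]; linarith
    refine absurd (hmin ⟨h1, by simp [hjB, h0], fun i => ?_, hless.le.trans hsum⟩)
      (not_le.2 hless)
    split_ifs with hi
    · exact hge i
    · have := h2 i (fun h => hi (h ▸ hjB))
      linarith

end Dependence

theorem not_tropSingular_of_isTriangular {r : ℕ} {M : Matrix (Fin r) (Fin r) ℝ}
    (h : ∀ σ : Equiv.Perm (Fin r), σ ≠ 1 → tropWeight M 1 < tropWeight M σ) :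
    ¬ TropSingular M := by
  rintro ⟨σ, ρ, hne, hσ, hρ⟩
  have hle : tropDet M ≤ tropWeight M 1 := Finset.inf'_le _ (Finset.mem_univ _)
  have h1 : ∀ σ, tropWeight M σ = tropDet M → σ = 1 := by
    intro σ hσ
    by_contra hc
    linarith [h σ hc]
  exact hne ((h1 σ hσ).trans (h1 ρ hρ).symm)

/-- A triangular system on the columns other than `k` would be a nonsingular maximal minor, so these
columns are dependent. The value inserted at `k` is arbitrary. -/
theorem exists_isRay {g n : ℕ} {A : Matrix (Fin g) (Fin (n + 2)) ℝ}
    (hA : ∀ (f : Fin (n + 1) ↪ Fin g) (e : Fin (n + 1) ↪ Fin (n + 2)),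
      TropSingular (A.submatrix f e))
    (k : Fin (n + 2)) : ∃ v, IsRay A v k := by
  obtain ⟨μ, hμ⟩ := exists_attainedTwice_of_not_isTriangular
    (A := fun r i => A r (k.succAbove i)) (by
      intro μ f o h
      exact not_tropSingular_of_isTriangular (fun σ hσ => by simpa [tropWeight] using h.sum_lt hσ)
        (hA ⟨f, h.injective⟩ k.succAboveEmb))
  refine ⟨k.insertNth 0 μ, fun r => ?_⟩
  obtain ⟨i, j, hij, hl⟩ := hμ r
  refine ⟨k.succAbove i, k.succAbove j, fun h => hij (Fin.succAbove_right_injective h),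
    Fin.succAbove_ne _ _, Fin.succAbove_ne _ _, fun l hlk => ?_⟩
  obtain ⟨l, rfl⟩ := Fin.exists_succAbove_eq hlk
  simpa using hl l

/-! ### Orders of monomials and their differences -/

namespace RealPuiseux

/-- The monomial `c τ^a`. -/
noncomputable def mono (a : ℝ) (c : ℂ) : RealPuiseux :=
  ⟨HahnSeries.single a c, fun _ =>
    ((Set.finite_singleton a).subset HahnSeries.support_single_subset).subset
      Set.inter_subset_left⟩

@[simp]
theorem coe_mono (a : ℝ) (c : ℂ) : (mono a c : HahnSeries ℝ ℂ) = HahnSeries.single a c :=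
  rfl

theorem mono_mul_mono (a b : ℝ) (c d : ℂ) : mono a c * mono b d = mono (a + b) (c * d) := by
  apply Subtype.ext
  simp [HahnSeries.single_mul_single]

theorem ord_eq_of_coeff {x : RealPuiseux} {s : ℝ} (hs : (x : HahnSeries ℝ ℂ).coeff s ≠ 0)
    (h : ∀ t < s, (x : HahnSeries ℝ ℂ).coeff t = 0) : x ≠ 0 ∧ ord x = s := by
  have hx : (x : HahnSeries ℝ ℂ) ≠ 0 := by
    intro h0
    simp [h0] at hs
  refine ⟨fun h0 => hx (by simp [h0]), le_antisymm (HahnSeries.order_le_of_coeff_ne_zero hs) ?_⟩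
  by_contra! hlt
  exact HahnSeries.coeff_order_eq_zero.not.2 hx (h _ hlt)

theorem ord_mul {x y : RealPuiseux} (hx : x ≠ 0) (hy : y ≠ 0) :
    ord (x * y) = ord x + ord y :=
  HahnSeries.order_mul (fun h => hx (Subtype.ext h)) (fun h => hy (Subtype.ext h))

theorem ord_neg (x : RealPuiseux) : ord (-x) = ord x :=
  HahnSeries.order_neg

theorem ord_mono {a : ℝ} {c : ℂ} (hc : c ≠ 0) : ord (mono a c) = a :=
  HahnSeries.order_single hc

theorem mono_ne_zero {a : ℝ} {c : ℂ} (hc : c ≠ 0) : mono a c ≠ 0 :=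
  fun h => HahnSeries.single_ne_zero hc (congrArg Subtype.val h)

theorem mono_sub_mono {s t : ℝ} {a b : ℂ} (ha : a ≠ 0) (h : s < t ∨ s = t ∧ a ≠ b) :
    mono s a - mono t b ≠ 0 ∧ ord (mono s a - mono t b) = s := by
  apply ord_eq_of_coeff
  · rcases h with h | ⟨rfl, h⟩
    · simpa [HahnSeries.coeff_single_of_ne h.ne] using ha
    · simpa [sub_eq_zero] using h
  · intro r hr
    have hrt : r ≠ t := by
      rcases h with h | h
      · exact (hr.trans h).ne
      · exact h.1 ▸ hr.ne
    simp [HahnSeries.coeff_single_of_ne hr.ne, HahnSeries.coeff_single_of_ne hrt]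

end RealPuiseux

open RealPuiseux

/-! ### Realizable tropical lines in the kernel -/

/-- There is a two-dimensional space of linear relations, spanned by `p` and `q`, whose circuits
tropicalize to points of the tropical kernel of `A`. -/
def HasPencil {ρ ι : Type*} (A : ρ → ι → ℝ) : Prop :=
  ∃ p q : ι → RealPuiseux, (∀ i j, i ≠ j → p i * q j - p j * q i ≠ 0) ∧
    ∀ k, IsRay A (fun i => ord (p i * q k - p k * q i)) k

theorem HasPencil.of_comp {ρ ι : Type*} {A : ρ → ι → ℝ} (s : Equiv.Perm ι)
    (h : HasPencil fun r i => A r (s i)) : HasPencil A := by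
  obtain ⟨p, q, hpq, hk⟩ := h
  refine ⟨p ∘ s.symm, q ∘ s.symm, fun i j hij => hpq _ _ (s.symm.injective.ne hij),
    fun k r => ?_⟩
  obtain ⟨i, j, hij, hi, hj, hl⟩ := hk (s.symm k) r
  refine ⟨s i, s j, s.injective.ne hij, fun h => hi (by simp [← h]), fun h => hj (by simp [← h]),
    fun l hlk => ?_⟩
  simpa using hl (s.symm l) (s.symm.injective.ne hlk)

section Kernel

variable {ρ ι : Type*} {A : ρ → ι → ℝ}

/-- This is the bend of the segment from `x` to `y` at index `k`. The point `y` touches it where the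
difference is at least that at `k`, and `x` where it is at most that; so one of them separates `k`
from each other index. -/
theorem isRay_min_of_sub_ne {x y : ι → ℝ} (hx : x ∈ tropKernel A) (hy : y ∈ tropKernel A) {k : ι}
    (hk : ∀ f, f ≠ k → x f - y f ≠ x k - y k) :
    IsRay A (fun i => min (x i) (y i + (x k - y k))) k := by
  refine isRay_of_separates (min_add_mem_tropKernel hx hy _) fun f hf => ?_
  rcases (hk f hf).lt_or_gt with h | h
  · refine ⟨y, hy, -(x k - y k), fun i => by linarith [min_le_right (x i) (y i + (x k - y k))],
      Or.inl ⟨by simp, ?_⟩⟩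
    have := min_le_left (x f) (y f + (x k - y k))
    linarith
  · refine ⟨x, hx, 0, fun i => by simp, Or.inl ⟨by simp, ?_⟩⟩
    have := min_le_right (x f) (y f + (x k - y k))
    linarith

/-- Two points whose coordinatewise differences are distinct span a tropical line in the kernel. -/
theorem hasPencil_of_injective_sub {x y : ι → ℝ} (hx : x ∈ tropKernel A) (hy : y ∈ tropKernel A)
    (hd : Function.Injective fun i => x i - y i) : HasPencil A := by
  -- With `p = τ^x` and `q = τ^y`, distinct differences exclude cancellation in the 2×2 minors.
  have hdet : ∀ i k, i ≠ k →
      mono (x i) 1 * mono (y k) 1 -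
        mono (x k) 1 * mono (y i) 1 ≠ 0 ∧
      ord (mono (x i) 1 * mono (y k) 1 -
        mono (x k) 1 * mono (y i) 1) = min (x i + y k) (x k + y i) := by
    intro i k hik
    simp only [mono_mul_mono, mul_one]
    have hne : x i + y k ≠ x k + y i := fun h => hik (hd (by simp only; linarith))
    rcases hne.lt_or_gt with h | h
    · rw [min_eq_left h.le]
      exact mono_sub_mono one_ne_zero (Or.inl h)
    · rw [min_eq_right h.le, ← neg_sub, ord_neg, neg_ne_zero]
      exact mono_sub_mono one_ne_zero (Or.inl h)
  refine ⟨_, _, fun i j hij => (hdet i j hij).1, fun k => ?_⟩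
  refine (isRay_min_of_sub_ne hx hy (k := k) fun f hf h => hf (hd h)).congr (y k) fun i hi => ?_
  rw [(hdet i k hi).2, ← min_add_add_right]
  congr 1
  ring

end Kernel

/-- Three rays at a point and two rays at another form a tropical line. -/
theorem hasPencil_of_isRay {ρ : Type*} {A : ρ → Fin 5 → ℝ} {v w : Fin 5 → ℝ} {u : ℝ} (hu : 0 ≤ u)
    (h0 : w 0 = v 0) (h1 : w 1 = v 1) (h2 : w 2 = v 2) (h3 : w 3 = v 3 + u) (h4 : w 4 = v 4 + u)
    (r0 : IsRay A v 0) (r1 : IsRay A v 1) (r2 : IsRay A v 2) (r3 : IsRay A w 3)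
    (r4 : IsRay A w 4) : HasPencil A := by
  let p : Fin 5 → RealPuiseux := fun i => mono (v i) 1
  -- The ratios `q / p` are 2, 3, 4, 0, `τ^u`: five distinct points of the projective line, of which
  -- only the last two are close, at distance `u`. They remain distinct for `u = 0`.
  let q : Fin 5 → RealPuiseux := ![mono (v 0) 2, mono (v 1) 3,
    mono (v 2) 4, 0, mono (v 4 + u) 1]
  -- As `i < j`, the condition `i = 3` singles out the pair of indices 3 and 4.
  have key : ∀ i j : Fin 5, i < j → p j * q i - p i * q j ≠ 0 ∧
      ord (p j * q i - p i * q j) = v i + v j + if i = 3 then u else 0 := by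
    have hsub : ∀ (a b u : ℝ) (c : ℂ), 0 ≤ u → c ≠ 0 → c ≠ 1 →
        mono b 1 * mono a c -
          mono a 1 * mono (b + u) 1 ≠ 0 ∧
        ord (mono b 1 * mono a c -
          mono a 1 * mono (b + u) 1) = a + b := by
      intro a b u c hu hc hc1
      simp only [mono_mul_mono, one_mul]
      rw [show b + a = a + b from add_comm _ _]
      refine mono_sub_mono hc ?_
      rcases hu.lt_or_eq with h | h
      · exact Or.inl (by linarith)
      · exact Or.inr ⟨by linarith, hc1⟩
    have hconst : ∀ (a b : ℝ) (c d : ℂ), c ≠ 0 → c ≠ d →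
        mono b 1 * mono a c -
          mono a 1 * mono b d ≠ 0 ∧
        ord (mono b 1 * mono a c -
          mono a 1 * mono b d) = a + b := by
      intro a b c d hc hcd
      simp only [mono_mul_mono, one_mul]
      rw [show b + a = a + b from add_comm _ _]
      exact mono_sub_mono hc (Or.inr ⟨rfl, hcd⟩)
    have hzero : ∀ (a b : ℝ) (c : ℂ), c ≠ 0 →
        mono b 1 * mono a c - mono a 1 * 0 ≠ 0 ∧
        ord (mono b 1 * mono a c - mono a 1 * 0) = a + b := by
      intro a b c hc
      rw [mul_zero, sub_zero, mono_mul_mono, one_mul, add_comm b a]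
      exact ⟨mono_ne_zero hc, ord_mono hc⟩
    have hlast : mono (v 4) 1 * 0 -
          mono (v 3) 1 * mono (v 4 + u) 1 ≠ 0 ∧
        ord (mono (v 4) 1 * 0 -
          mono (v 3) 1 * mono (v 4 + u) 1) = v 3 + v 4 + u := by
      rw [mul_zero, zero_sub, neg_ne_zero, ord_neg, mono_mul_mono, one_mul,
        ← add_assoc]
      exact ⟨mono_ne_zero one_ne_zero, ord_mono one_ne_zero⟩
    intro i j hij
    fin_cases i <;> fin_cases j <;> simp [p, q] at hij ⊢
    · exact hconst _ _ _ _ (by norm_num) (by norm_num)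
    · exact hconst _ _ _ _ (by norm_num) (by norm_num)
    · simpa using hzero (v 0) (v 3) 2 (by norm_num)
    · exact hsub _ _ _ _ hu (by norm_num) (by norm_num)
    · exact hconst _ _ _ _ (by norm_num) (by norm_num)
    · simpa using hzero (v 1) (v 3) 3 (by norm_num)
    · exact hsub _ _ _ _ hu (by norm_num) (by norm_num)
    · simpa using hzero (v 2) (v 3) 4 (by norm_num)
    · exact hsub _ _ _ _ hu (by norm_num) (by norm_num)
    · simpa using hlast
  have key' : ∀ i j : Fin 5, i ≠ j → p i * q j - p j * q i ≠ 0 ∧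
      ord (p i * q j - p j * q i) = v i + v j + if min i j = 3 then u else 0 := by
    intro i j hij
    rcases hij.lt_or_gt with h | h
    · rw [← neg_sub, ord_neg, neg_ne_zero, min_eq_left h.le]
      exact key i j h
    · rw [min_eq_right h.le, add_comm (v i)]
      exact key j i h
  refine ⟨p, q, fun i j hij => (key' i j hij).1, fun k => ?_⟩
  fin_cases k
  · exact r0.congr (v 0) fun i hi => by
      have := (key' i 0 hi).2
      fin_cases i <;> simp_all
  · exact r1.congr (v 1) fun i hi => by
      have := (key' i 1 hi).2
      fin_cases i <;> simp_all
  · exact r2.congr (v 2) fun i hi => by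
      have := (key' i 2 hi).2
      fin_cases i <;> simp_all
  · exact r3.congr (v 3) fun i hi => by
      have := (key' i 3 hi).2
      fin_cases i <;> simp_all
      ring
  · exact r4.congr (v 4) fun i hi => by
      have := (key' i 4 hi).2
      fin_cases i <;> simp_all
      ring

section Kernel

variable {ρ ι : Type*} {A : ρ → ι → ℝ}

theorem mem_tropKernel_comp {v : ι → ℝ} (hv : v ∈ tropKernel A) (s : Equiv.Perm ι) :
    (fun i => v (s i)) ∈ tropKernel fun r i => A r (s i) := by
  intro r
  obtain ⟨i, j, hij, hl⟩ := hv r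
  exact ⟨s.symm i, s.symm j, s.symm.injective.ne hij, fun l => by simpa using hl (s l)⟩

theorem IsRay.comp {v : ι → ℝ} {k : ι} (s : Equiv.Perm ι) (hv : IsRay A v (s k)) :
    IsRay (fun r i => A r (s i)) (fun i => v (s i)) k := by
  intro r
  obtain ⟨i, j, hij, hi, hj, hl⟩ := hv r
  exact ⟨s.symm i, s.symm j, s.symm.injective.ne hij, fun h => hi (by simp [← h]),
    fun h => hj (by simp [← h]), fun l hlk => by simpa using hl (s l) (s.injective.ne hlk)⟩

theorem exists_isRay_comp (h : ∀ k, ∃ v, IsRay A v k) (s : Equiv.Perm ι) (k : ι) :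
    ∃ v, IsRay (fun r i => A r (s i)) v k :=
  let ⟨_, hv⟩ := h (s k)
  ⟨_, hv.comp s⟩

theorem IsRay.exists_mem [Finite ρ] {v : ι → ℝ} {k : ι} (hv : IsRay A v k) (b : ℝ) :
    ∃ y ∈ tropKernel A, b < y k ∧ ∀ i, i ≠ k → y i = v i := by
  classical
  obtain ⟨t, ht, hb⟩ := (hv.eventually_update_mem.and (Filter.eventually_gt_atTop b)).exists
  exact ⟨_, ht, by simpa using hb, fun i hi => by simp [hi]⟩

/-- Far out on the ray, the difference at `k` exceeds all others, so only ties among the other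
indices matter. -/
theorem hasPencil_of_isRay_of_mem [Finite ρ] [Finite ι] {z w : ι → ℝ} {k : ι} (hz : IsRay A z k)
    (hw : w ∈ tropKernel A) (hd : Set.InjOn (fun i => z i - w i) {i | i ≠ k}) : HasPencil A := by
  obtain ⟨b, hb⟩ := (Set.finite_range fun i => z i - w i + w k).bddAbove
  obtain ⟨y, hy, hyk, hyz⟩ := hz.exists_mem b
  refine hasPencil_of_injective_sub hy hw fun i j hij => ?_
  have hlt : ∀ i, z i - w i < y k - w k := fun i => by linarith [hb ⟨i, rfl⟩]
  simp only at hij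
  by_cases hi : i = k <;> by_cases hj : j = k
  · rw [hi, hj]
  · rw [hi, hyz j hj] at hij
    linarith [hlt j]
  · rw [hj, hyz i hi] at hij
    linarith [hlt i]
  · rw [hyz i hi, hyz j hj] at hij
    exact hd hi hj hij

theorem hasPencil_of_isRay_of_isRay [Finite ρ] [Finite ι] {z w : ι → ℝ} {k l : ι}
    (hz : IsRay A z k) (hw : IsRay A w l) (hd : Set.InjOn (fun i => z i - w i) {i | i ≠ k ∧ i ≠ l}) :
    HasPencil A := by
  obtain ⟨b, hb⟩ := (Set.finite_range fun i => w i - z i + z l).bddAbove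
  obtain ⟨y, hy, hyl, hyw⟩ := hw.exists_mem b
  refine hasPencil_of_isRay_of_mem hz hy fun i hi j hj hij => ?_
  have hlt : ∀ i, z l - y l < z i - w i := fun i => by linarith [hb ⟨i, rfl⟩]
  simp only at hij
  by_cases hi' : i = l <;> by_cases hj' : j = l
  · rw [hi', hj']
  · rw [hi', hyw j hj'] at hij
    linarith [hlt j]
  · rw [hj', hyw i hi'] at hij
    linarith [hlt i]
  · rw [hyw i hi', hyw j hj'] at hij
    exact hd ⟨hi, hi'⟩ ⟨hj, hj'⟩ hij

theorem Separates.symm {y z : ι → ℝ} {k f : ι} (h : Separates y z k f) : Separates y z f k := by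
  obtain ⟨c, hc, h⟩ := h
  exact ⟨c, hc, h.symm⟩

end Kernel

theorem Separates.of_left {y z : Fin 5 → ℝ} {k f : Fin 5} (c : ℝ) (h0 : z 0 + c ≤ y 0)
    (h1 : z 1 + c ≤ y 1) (h2 : z 2 + c ≤ y 2) (h3 : z 3 + c ≤ y 3) (h4 : z 4 + c ≤ y 4)
    (hk : y k = z k + c) (hf : z f + c < y f) : Separates y z k f :=
  ⟨c, fun i => by fin_cases i <;> assumption, Or.inl ⟨hk, hf⟩⟩

/-! ### Splitting a leaf with two indices -/

section Five

variable {ρ : Type*} {A : ρ → Fin 5 → ℝ}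

theorem hasPencil_of_separates {z : Fin 5 → ℝ} (hz : z ∈ tropKernel A)
    (h : ∀ k f : Fin 5, k < f → ∃ y ∈ tropKernel A, Separates y z k f) : HasPencil A := by
  have hr : ∀ k, IsRay A z k := fun k => isRay_of_separates hz fun f hf => by
    rcases hf.lt_or_gt with hf | hf
    · obtain ⟨y, hy, hs⟩ := h f k hf
      exact ⟨y, hy, hs.symm⟩
    · exact h k f hf
  exact hasPencil_of_isRay le_rfl rfl rfl rfl (by simp) (by simp) (hr 0) (hr 1) (hr 2) (hr 3) (hr 4)

set_option maxHeartbeats 2000000 in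
/-- A tropical line with four leaves, one of which still carries the two indices `0` and `1`, can
be refined to a tropical line with five leaves. -/
theorem hasPencil_of_four_leaves [Finite ρ] (hA : ∃ z, IsRay A z 0) {v w : Fin 5 → ℝ} {u : ℝ}
    (hv : v ∈ tropKernel A) (hw : w ∈ tropKernel A) (hu : 0 < u) (hw0 : w 0 = v 0)
    (hw1 : w 1 = v 1) (hw2 : w 2 = v 2) (hw3 : w 3 = v 3 + u) (hw4 : w 4 = v 4 + u)
    (r2 : IsRay A v 2) (r3 : IsRay A w 3) (r4 : IsRay A w 4) : HasPencil A := by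
  obtain ⟨z', hz'⟩ := hA
  obtain ⟨z, hz, hz1⟩ : ∃ z, IsRay A z 0 ∧ z 1 = v 1 :=
    ⟨fun i => z' i + (v 1 - z' 1), hz'.congr _ fun _ _ => rfl, by simp⟩
  by_contra hno
  -- Without a pencil, `z` must have a coincidence of differences with every point of the known
  -- line. These are tested on the leaf 2, on the leaf 3 and in the interior of the edge; the last
  -- uses a generic `τ`.
  have e1 : z 3 = v 3 ∨ z 4 = v 4 ∨ z 3 - v 3 = z 4 - v 4 := by
    by_contra! hc
    refine hno (hasPencil_of_isRay_of_isRay hz r2 ?_)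
    rintro i ⟨hi, hi'⟩ j ⟨hj, hj'⟩ hij
    fin_cases i <;> fin_cases j <;> simp at hi hi' hj hj' hij ⊢ <;> grind
  have e2 : z 2 = v 2 ∨ z 4 - v 4 = u ∨ z 2 - v 2 = z 4 - v 4 - u := by
    by_contra! hc
    refine hno (hasPencil_of_isRay_of_isRay hz r3 ?_)
    rintro i ⟨hi, hi'⟩ j ⟨hj, hj'⟩ hij
    fin_cases i <;> fin_cases j <;> simp at hi hi' hj hj' hij ⊢ <;> grind
  have e3 : z 2 = v 2 ∨ z 3 - v 3 = z 4 - v 4 := by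
    by_contra! hc
    obtain ⟨τ, ⟨hτ0, hτu⟩, hτ⟩ := ((Set.Ioo_infinite hu).sdiff
      (Set.toFinite {z 3 - v 3, z 4 - v 4, z 3 - v 3 - (z 2 - v 2),
        z 4 - v 4 - (z 2 - v 2)})).nonempty
    simp only [Set.mem_insert_iff, Set.mem_singleton_iff, not_or] at hτ
    refine hno (hasPencil_of_isRay_of_mem hz (min_add_mem_tropKernel hw hv τ) ?_)
    have m1 : min (w 1) (v 1 + τ) = v 1 := by rw [hw1]; exact min_eq_left (by linarith)
    have m2 : min (w 2) (v 2 + τ) = v 2 := by rw [hw2]; exact min_eq_left (by linarith)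
    have m3 : min (w 3) (v 3 + τ) = v 3 + τ := by rw [hw3]; exact min_eq_right (by linarith)
    have m4 : min (w 4) (v 4 + τ) = v 4 + τ := by rw [hw4]; exact min_eq_right (by linarith)
    intro i hi j hj hij
    fin_cases i <;> fin_cases j <;> simp [m1, m2, m3, m4] at hi hj hij ⊢ <;> grind
  obtain ⟨y, hy, hy0, hyz⟩ :=
    hz.exists_mem (v 0 + |z 2 - v 2| + |z 3 - v 3| + |z 4 - v 4| + u)
  have hy1 := hyz 1 (by decide)
  have hy2 := hyz 2 (by decide)
  have hy3 := hyz 3 (by decide)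
  have hy4 := hyz 4 (by decide)
  replace hy0 : v 0 + u < y 0 := by
    linarith [abs_nonneg (z 2 - v 2), abs_nonneg (z 3 - v 3), abs_nonneg (z 4 - v 4)]
  obtain ⟨a, ha, ha2, hav⟩ := r2.exists_mem (v 2)
  have ha0 := hav 0 (by decide)
  have ha1 := hav 1 (by decide)
  have ha3 := hav 3 (by decide)
  have ha4 := hav 4 (by decide)
  obtain ⟨b, hb, hb3, hbw⟩ := r3.exists_mem (w 3)
  have hb0 := hbw 0 (by decide)
  have hb1 := hbw 1 (by decide)
  have hb2 := hbw 2 (by decide)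
  have hb4 := hbw 4 (by decide)
  obtain ⟨c, hc, hc4, hcw⟩ := r4.exists_mem (w 4)
  have hc0 := hcw 0 (by decide)
  have hc1 := hcw 1 (by decide)
  have hc2 := hcw 2 (by decide)
  have hc3 := hcw 3 (by decide)
  clear hyz hav hbw hcw
  have lower : ∀ p ∈ tropKernel A, p 0 = v 0 → ∃ q ∈ tropKernel A, q 0 = v 0 ∧
      q 1 = min (p 1) (z 1) ∧ q 2 = min (p 2) (z 2) ∧ q 3 = min (p 3) (z 3) ∧
      q 4 = min (p 4) (z 4) := by
    intro p hp hp0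
    refine ⟨_, min_mem_tropKernel hp hy, ?_, by rw [hy1], by rw [hy2], by rw [hy3], by rw [hy4]⟩
    rw [hp0]
    exact min_eq_left (by linarith)
  -- Here `y` touches `v` at 1 but not at 0, so it splits the double leaf at `v` itself.
  by_cases hpos : v 2 ≤ z 2 ∧ v 3 ≤ z 3 ∧ v 4 ≤ z 4
  · obtain ⟨h2, h3, h4⟩ := hpos
    refine hno (hasPencil_of_isRay hu.le hw0 hw1 hw2 hw3 hw4
      (isRay_of_separates hv fun f hf => ?_) (isRay_of_separates hv fun f hf => ?_) r2 r3 r4)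
    · fin_cases f
      · exact absurd rfl hf
      · exact ⟨y, hy, Separates.symm (by apply Separates.of_left 0 <;> (try dsimp) <;> linarith)⟩
      · exact ⟨a, ha, by apply Separates.of_left 0 <;> (try dsimp) <;> linarith⟩
      · exact ⟨w, hw, by apply Separates.of_left 0 <;> (try dsimp) <;> linarith⟩
      · exact ⟨w, hw, by apply Separates.of_left 0 <;> (try dsimp) <;> linarith⟩
    · fin_cases f
      · exact ⟨y, hy, by apply Separates.of_left 0 <;> (try dsimp) <;> linarith⟩
      · exact absurd rfl hf
      · exact ⟨a, ha, by apply Separates.of_left 0 <;> (try dsimp) <;> linarith⟩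
      · exact ⟨w, hw, by apply Separates.of_left 0 <;> (try dsimp) <;> linarith⟩
      · exact ⟨w, hw, by apply Separates.of_left 0 <;> (try dsimp) <;> linarith⟩
  by_cases h2 : z 2 = v 2
  -- Some coordinate of `z` now lies below `v`, so the splitting takes place at the lower point `min
  -- v y`. If only one of the coordinates 3 and 4 drops, all five leaves meet at `q`.
  · obtain ⟨q, hq, q0, q1, q2, q3, q4⟩ := lower v hv rfl
    rw [hz1, min_self] at q1
    rw [h2, min_self] at q2
    have hneg : z 3 < v 3 ∨ z 4 < v 4 := by
      by_contra! hc
      exact hpos ⟨h2.ge, hc⟩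
    by_cases h3 : z 3 = v 3
    · have h4 : z 4 < v 4 := hneg.resolve_left (by linarith)
      rw [h3, min_self] at q3
      rw [min_eq_right h4.le] at q4
      refine hno (hasPencil_of_separates hq ?_)
      intro k f hkf
      fin_cases k <;> fin_cases f <;> first | exact absurd hkf (by decide) | skip
      · exact ⟨y, hy, Separates.symm (by apply Separates.of_left 0 <;> (try dsimp) <;> linarith)⟩
      · exact ⟨y, hy, Separates.symm (by apply Separates.of_left 0 <;> (try dsimp) <;> linarith)⟩
      · exact ⟨y, hy, Separates.symm (by apply Separates.of_left 0 <;> (try dsimp) <;> linarith)⟩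
      · exact ⟨y, hy, Separates.symm (by apply Separates.of_left 0 <;> (try dsimp) <;> linarith)⟩
      · exact ⟨a, ha, by apply Separates.of_left 0 <;> (try dsimp) <;> linarith⟩
      · exact ⟨w, hw, by apply Separates.of_left 0 <;> (try dsimp) <;> linarith⟩
      · exact ⟨v, hv, by apply Separates.of_left 0 <;> (try dsimp) <;> linarith⟩
      · exact ⟨a, ha, Separates.symm (by apply Separates.of_left 0 <;> (try dsimp) <;> linarith)⟩
      · exact ⟨v, hv, by apply Separates.of_left 0 <;> (try dsimp) <;> linarith⟩
      · exact ⟨v, hv, by apply Separates.of_left 0 <;> (try dsimp) <;> linarith⟩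
    by_cases h4 : z 4 = v 4
    · have h3 : z 3 < v 3 := hneg.resolve_right (by linarith)
      rw [h4, min_self] at q4
      rw [min_eq_right h3.le] at q3
      refine hno (hasPencil_of_separates hq ?_)
      intro k f hkf
      fin_cases k <;> fin_cases f <;> first | exact absurd hkf (by decide) | skip
      · exact ⟨y, hy, Separates.symm (by apply Separates.of_left 0 <;> (try dsimp) <;> linarith)⟩
      · exact ⟨y, hy, Separates.symm (by apply Separates.of_left 0 <;> (try dsimp) <;> linarith)⟩
      · exact ⟨y, hy, Separates.symm (by apply Separates.of_left 0 <;> (try dsimp) <;> linarith)⟩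
      · exact ⟨y, hy, Separates.symm (by apply Separates.of_left 0 <;> (try dsimp) <;> linarith)⟩
      · exact ⟨a, ha, by apply Separates.of_left 0 <;> (try dsimp) <;> linarith⟩
      · exact ⟨v, hv, by apply Separates.of_left 0 <;> (try dsimp) <;> linarith⟩
      · exact ⟨w, hw, by apply Separates.of_left 0 <;> (try dsimp) <;> linarith⟩
      · exact ⟨v, hv, by apply Separates.of_left 0 <;> (try dsimp) <;> linarith⟩
      · exact ⟨w, hw, by apply Separates.of_left 0 <;> (try dsimp) <;> linarith⟩
      · exact ⟨v, hv, Separates.symm (by apply Separates.of_left 0 <;> (try dsimp) <;> linarith)⟩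
    have h34 : z 3 - v 3 = z 4 - v 4 := by tauto
    have h3 : z 3 < v 3 := by rcases hneg with h | h <;> linarith
    rw [min_eq_right h3.le] at q3
    rw [min_eq_right (by linarith)] at q4
    -- Coordinates 3 and 4 drop by the same amount, so `q` prolongs the edge from `w` through `v`,
    -- with the leaves 0, 1, 2 at its new end.
    refine hno (hasPencil_of_isRay (v := q) (w := w) (u := u + (v 3 - z 3)) (by linarith)
      (by linarith) (by linarith) (by linarith) (by linarith) (by linarith)
      (isRay_of_separates hq fun f hf => ?_) (isRay_of_separates hq fun f hf => ?_)
      (isRay_of_separates hq fun f hf => ?_) r3 r4)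
    · fin_cases f
      · exact absurd rfl hf
      · exact ⟨y, hy, Separates.symm (by apply Separates.of_left 0 <;> (try dsimp) <;> linarith)⟩
      · exact ⟨y, hy, Separates.symm (by apply Separates.of_left 0 <;> (try dsimp) <;> linarith)⟩
      · exact ⟨y, hy, Separates.symm (by apply Separates.of_left 0 <;> (try dsimp) <;> linarith)⟩
      · exact ⟨y, hy, Separates.symm (by apply Separates.of_left 0 <;> (try dsimp) <;> linarith)⟩
    · fin_cases f
      · exact ⟨y, hy, by apply Separates.of_left 0 <;> (try dsimp) <;> linarith⟩
      · exact absurd rfl hf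
      · exact ⟨a, ha, by apply Separates.of_left 0 <;> (try dsimp) <;> linarith⟩
      · exact ⟨v, hv, by apply Separates.of_left 0 <;> (try dsimp) <;> linarith⟩
      · exact ⟨v, hv, by apply Separates.of_left 0 <;> (try dsimp) <;> linarith⟩
    · fin_cases f
      · exact ⟨y, hy, by apply Separates.of_left 0 <;> (try dsimp) <;> linarith⟩
      · exact ⟨a, ha, Separates.symm (by apply Separates.of_left 0 <;> (try dsimp) <;> linarith)⟩
      · exact absurd rfl hf
      · exact ⟨v, hv, by apply Separates.of_left 0 <;> (try dsimp) <;> linarith⟩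
      · exact ⟨v, hv, by apply Separates.of_left 0 <;> (try dsimp) <;> linarith⟩
  have h34 : z 3 - v 3 = z 4 - v 4 := by tauto
  obtain ⟨q, hq, q0, q1, q2, q3, q4⟩ := lower w hw hw0
  rw [hw1, hz1, min_self] at q1
  have hneg : z 2 < v 2 := by
    by_contra! hc
    refine hpos ⟨hc, ?_⟩
    rcases e2 with h | h | h
    · exact absurd h h2
    · constructor <;> linarith
    · constructor <;> linarith
  rw [hw2, min_eq_right hneg.le] at q2
  -- In this case `q` is `w` with only coordinate 2 lowered, and all five leaves meet there.
  by_cases h4 : z 4 - v 4 = u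
  · rw [min_eq_left (by linarith)] at q3 q4
    refine hno (hasPencil_of_separates hq ?_)
    intro k f hkf
    fin_cases k <;> fin_cases f <;> first | exact absurd hkf (by decide) | skip
    · exact ⟨y, hy, Separates.symm (by apply Separates.of_left 0 <;> (try dsimp) <;> linarith)⟩
    · exact ⟨y, hy, Separates.symm (by apply Separates.of_left 0 <;> (try dsimp) <;> linarith)⟩
    · exact ⟨y, hy, Separates.symm (by apply Separates.of_left 0 <;> (try dsimp) <;> linarith)⟩
    · exact ⟨y, hy, Separates.symm (by apply Separates.of_left 0 <;> (try dsimp) <;> linarith)⟩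
    · exact ⟨w, hw, by apply Separates.of_left 0 <;> (try dsimp) <;> linarith⟩
    · exact ⟨b, hb, by apply Separates.of_left 0 <;> (try dsimp) <;> linarith⟩
    · exact ⟨c, hc, by apply Separates.of_left 0 <;> (try dsimp) <;> linarith⟩
    · exact ⟨w, hw, Separates.symm (by apply Separates.of_left 0 <;> (try dsimp) <;> linarith)⟩
    · exact ⟨w, hw, Separates.symm (by apply Separates.of_left 0 <;> (try dsimp) <;> linarith)⟩
    · exact ⟨b, hb, Separates.symm (by apply Separates.of_left 0 <;> (try dsimp) <;> linarith)⟩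
  have h24 : z 2 - v 2 = z 4 - v 4 - u := by tauto
  rw [min_eq_right (by linarith)] at q3 q4
  have hq0 : IsRay A q 0 := by
    refine isRay_of_separates hq fun f hf => ?_
    fin_cases f
    · exact absurd rfl hf
    · exact ⟨y, hy, Separates.symm (by apply Separates.of_left 0 <;> (try dsimp) <;> linarith)⟩
    · exact ⟨y, hy, Separates.symm (by apply Separates.of_left 0 <;> (try dsimp) <;> linarith)⟩
    · exact ⟨y, hy, Separates.symm (by apply Separates.of_left 0 <;> (try dsimp) <;> linarith)⟩
    · exact ⟨y, hy, Separates.symm (by apply Separates.of_left 0 <;> (try dsimp) <;> linarith)⟩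
  have hq1 : IsRay A q 1 := by
    refine isRay_of_separates hq fun f hf => ?_
    fin_cases f
    · exact ⟨y, hy, by apply Separates.of_left 0 <;> (try dsimp) <;> linarith⟩
    · exact absurd rfl hf
    · exact ⟨w, hw, by apply Separates.of_left 0 <;> (try dsimp) <;> linarith⟩
    · exact ⟨w, hw, by apply Separates.of_left 0 <;> (try dsimp) <;> linarith⟩
    · exact ⟨w, hw, by apply Separates.of_left 0 <;> (try dsimp) <;> linarith⟩
  have hw2' : IsRay A w 2 := by
    refine isRay_of_separates hw fun f hf => ?_
    fin_cases f
    · exact ⟨q, hq, by apply Separates.of_left (z 2 - v 2) <;> (try dsimp) <;> linarith⟩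
    · exact ⟨q, hq, by apply Separates.of_left (z 2 - v 2) <;> (try dsimp) <;> linarith⟩
    · exact absurd rfl hf
    · exact ⟨b, hb, by apply Separates.of_left 0 <;> (try dsimp) <;> linarith⟩
    · exact ⟨c, hc, by apply Separates.of_left 0 <;> (try dsimp) <;> linarith⟩
  -- Now `q` is `w` with coordinates 2, 3, 4 lowered equally: the leaves 2, 3, 4 are at `w` and 0, 1
  -- at `q`. The cyclic shift by 2, and the addition of a constant to `q`, give the standard form.
  refine hno (HasPencil.of_comp (Equiv.addRight 2) ?_)
  have hray : ∀ k, IsRay A q k → IsRay A (fun i => q i + (v 2 - z 2)) k := fun k h =>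
    h.congr _ fun _ _ => rfl
  refine hasPencil_of_isRay (v := fun i => w (Equiv.addRight 2 i))
    (w := fun i => q (Equiv.addRight 2 i) + (v 2 - z 2)) (u := v 2 - z 2) (by linarith)
    ?_ ?_ ?_ ?_ ?_ (IsRay.comp _ hw2') (IsRay.comp _ r3) (IsRay.comp _ r4)
    (IsRay.comp (v := fun i => q i + (v 2 - z 2)) (k := 3) _ (hray 0 hq0))
    (IsRay.comp (v := fun i => q i + (v 2 - z 2)) (k := 4) _ (hray 1 hq1))
  · change q 2 + (v 2 - z 2) = w 2
    linarith
  · change q 3 + (v 2 - z 2) = w 3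
    linarith
  · change q 4 + (v 2 - z 2) = w 4
    linarith
  · change q 0 + (v 2 - z 2) = w 0 + (v 2 - z 2)
    linarith
  · change q 1 + (v 2 - z 2) = w 1 + (v 2 - z 2)
    linarith

end Five

/-! ### From five rays to a tropical line -/

section Five

variable {ρ : Type*} [Finite ρ] {A : ρ → Fin 5 → ℝ}

theorem hasPencil_of_sub_eq_of_lt (hA : ∃ z, IsRay A z 0) {x y : Fin 5 → ℝ}
    (hx : x ∈ tropKernel A) (hy : y ∈ tropKernel A) (h01 : x 0 - y 0 = x 1 - y 1)
    (h02 : x 0 - y 0 ≠ x 2 - y 2) (h03 : x 3 - y 3 < x 0 - y 0) (h23 : x 3 - y 3 < x 2 - y 2)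
    (h34 : x 4 - y 4 < x 3 - y 3) : HasPencil A := by
  -- The points `v` and `w` are the bends of the segment at levels `t`, the smaller of the
  -- differences at 0 and 2, and `x 3 - y 3`.
  obtain ⟨t, ht, ht0, ht2, htd⟩ : ∃ t, x 3 - y 3 < t ∧ t ≤ x 0 - y 0 ∧ t ≤ x 2 - y 2 ∧
      (t = x 0 - y 0 ∨ t = x 2 - y 2) := by
    rcases h02.lt_or_gt with h | h
    · exact ⟨_, h03, le_rfl, h.le, Or.inl rfl⟩
    · exact ⟨_, h23, h.le, le_rfl, Or.inr rfl⟩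
  obtain ⟨v, hv, v0, v1, v2, v3, v4⟩ : ∃ v ∈ tropKernel A, v 0 = y 0 + t ∧ v 1 = y 1 + t ∧
      v 2 = y 2 + t ∧ v 3 = x 3 ∧ v 4 = x 4 :=
    ⟨_, min_add_mem_tropKernel hx hy t, min_eq_right (by linarith), min_eq_right (by linarith),
      min_eq_right (by linarith), min_eq_left (by linarith), min_eq_left (by linarith)⟩
  obtain ⟨w, hw, w0, w1, w2, w3, w4, r3⟩ : ∃ w ∈ tropKernel A, w 0 = v 0 ∧ w 1 = v 1 ∧
      w 2 = v 2 ∧ w 3 = v 3 + (t - (x 3 - y 3)) ∧ w 4 = v 4 + (t - (x 3 - y 3)) ∧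
      IsRay A w 3 := by
    refine ⟨_, add_const_mem_tropKernel (min_add_mem_tropKernel hx hy (x 3 - y 3))
      (t - (x 3 - y 3)), ?_, ?_, ?_, ?_, ?_, ?_⟩
    · rw [min_eq_right (by linarith)]; linarith
    · rw [min_eq_right (by linarith)]; linarith
    · rw [min_eq_right (by linarith)]; linarith
    · rw [min_eq_left (by linarith)]; linarith
    · rw [min_eq_left (by linarith)]; linarith
    · refine (isRay_min_of_sub_ne hx hy (k := 3) fun f hf => ?_).congr _ fun _ _ => rfl
      fin_cases f
      · exact h03.ne'
      · dsimp; linarith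
      · exact h23.ne'
      · exact absurd rfl hf
      · exact h34.ne
  refine hasPencil_of_four_leaves hA hv hw (by linarith) w0 w1 w2 w3 w4
    (isRay_of_separates hv fun f hf => ?_) r3 (isRay_of_separates hw fun f hf => ?_)
  · have h01' : Separates x v 2 0 ∧ Separates x v 2 1 := by
      rcases htd with h | h
      · have h2 : t < x 2 - y 2 := ht2.lt_of_ne (h ▸ h02)
        constructor
        · exact .symm (by apply Separates.of_left 0 <;> linarith)
        · exact .symm (by apply Separates.of_left 0 <;> linarith)
      · have h0 : t < x 0 - y 0 := ht0.lt_of_ne (h ▸ h02.symm)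
        constructor
        · apply Separates.of_left 0 <;> linarith
        · apply Separates.of_left 0 <;> linarith
    fin_cases f
    · exact ⟨x, hx, h01'.1⟩
    · exact ⟨x, hx, h01'.2⟩
    · exact absurd rfl hf
    · exact ⟨w, hw, by apply Separates.of_left 0 <;> (try dsimp) <;> linarith⟩
    · exact ⟨w, hw, by apply Separates.of_left 0 <;> (try dsimp) <;> linarith⟩
  · refine ⟨y, hy, Separates.symm ?_⟩
    fin_cases f
    · apply Separates.of_left (-t) <;> (try dsimp) <;> linarith
    · apply Separates.of_left (-t) <;> (try dsimp) <;> linarith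
    · apply Separates.of_left (-t) <;> (try dsimp) <;> linarith
    · apply Separates.of_left (-t) <;> (try dsimp) <;> linarith
    · exact absurd rfl hf

/-- Exchange of `x` and `y` negates the differences, so the tied value may be assumed to exceed the
middle one of the other three. -/
theorem hasPencil_of_sub_eq_of_sorted (hA : ∃ z, IsRay A z 0) {x y : Fin 5 → ℝ}
    (hx : x ∈ tropKernel A) (hy : y ∈ tropKernel A) (h01 : x 0 - y 0 = x 1 - y 1)
    (h02 : x 0 - y 0 ≠ x 2 - y 2) (h03 : x 0 - y 0 ≠ x 3 - y 3) (h04 : x 0 - y 0 ≠ x 4 - y 4)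
    (h23 : x 3 - y 3 < x 2 - y 2) (h34 : x 4 - y 4 < x 3 - y 3) : HasPencil A := by
  rcases h03.lt_or_gt with h | h
  · obtain ⟨z, hz⟩ := hA
    let s : Equiv.Perm (Fin 5) := Equiv.swap 2 4
    exact .of_comp s (hasPencil_of_sub_eq_of_lt ⟨_, IsRay.comp (k := 0) s hz⟩
      (mem_tropKernel_comp hy s) (mem_tropKernel_comp hx s)
      (show y 0 - x 0 = y 1 - x 1 by linarith)
      (show y 0 - x 0 ≠ y 4 - x 4 from fun h => h04 (by linarith))
      (show y 3 - x 3 < y 0 - x 0 by linarith) (show y 3 - x 3 < y 4 - x 4 by linarith)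
      (show y 2 - x 2 < y 3 - x 3 by linarith))
  · exact hasPencil_of_sub_eq_of_lt hA hx hy h01 h02 h h23 h34

/-- Two points whose coordinatewise differences are distinct except for one tie. -/
theorem hasPencil_of_sub_eq (hA : ∃ z, IsRay A z 0) {x y : Fin 5 → ℝ}
    (hx : x ∈ tropKernel A) (hy : y ∈ tropKernel A) (h01 : x 0 - y 0 = x 1 - y 1)
    (h02 : x 0 - y 0 ≠ x 2 - y 2) (h03 : x 0 - y 0 ≠ x 3 - y 3) (h04 : x 0 - y 0 ≠ x 4 - y 4)
    (h23 : x 2 - y 2 ≠ x 3 - y 3) (h24 : x 2 - y 2 ≠ x 4 - y 4) (h34 : x 3 - y 3 ≠ x 4 - y 4) :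
    HasPencil A := by
  have hs : ∃ s : Equiv.Perm (Fin 5), s 0 = 0 ∧ s 1 = 1 ∧
      x (s 3) - y (s 3) < x (s 2) - y (s 2) ∧ x (s 4) - y (s 4) < x (s 3) - y (s 3) := by
    rcases h23.lt_or_gt with a | a <;> rcases h24.lt_or_gt with b | b <;>
      rcases h34.lt_or_gt with c | c
    · exact ⟨Equiv.swap 2 4, by decide, by decide, c, a⟩
    · exact ⟨Equiv.swap 2 4 * Equiv.swap 2 3, by decide, by decide, c, b⟩
    · exact absurd (a.trans c) b.not_gt
    · exact ⟨Equiv.swap 2 3, by decide, by decide, a, b⟩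
    · exact ⟨Equiv.swap 2 3 * Equiv.swap 2 4, by decide, by decide, b, a⟩
    · exact absurd (c.trans a) b.not_gt
    · exact ⟨Equiv.swap 3 4, by decide, by decide, b, c⟩
    · exact ⟨1, rfl, rfl, a, c⟩
  obtain ⟨s, s0, s1, h1, h2⟩ := hs
  have hne : ∀ i, 2 ≤ i → x 0 - y 0 ≠ x (s i) - y (s i) := by
    intro i hi
    have hi0 : s i ≠ 0 := fun h => by
      have := s.injective (h.trans s0.symm)
      subst this
      exact absurd hi (by decide)
    have hi1 : s i ≠ 1 := fun h => by
      have := s.injective (h.trans s1.symm)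
      subst this
      exact absurd hi (by decide)
    generalize s i = k at hi0 hi1
    fin_cases k
    · exact absurd rfl hi0
    · exact absurd rfl hi1
    · exact h02
    · exact h03
    · exact h04
  obtain ⟨z, hz⟩ := hA
  exact .of_comp s (hasPencil_of_sub_eq_of_sorted ⟨_, IsRay.comp (k := 0) s (s0.symm ▸ hz)⟩
    (mem_tropKernel_comp hx s) (mem_tropKernel_comp hy s) (by simpa only [s0, s1] using h01)
    (by simpa only [s0] using hne 2 (by decide)) (by simpa only [s0] using hne 3 (by decide))
    (by simpa only [s0] using hne 4 (by decide)) h1 h2)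

/-- Far out on both rays, the differences at 0 and 1 become extreme in opposite directions, which
leaves the tie between 2 and 3 as the only one. -/
theorem hasPencil_of_two_rays_of_eq (hA : ∀ k, ∃ z, IsRay A z k) {z w : Fin 5 → ℝ}
    (hz : IsRay A z 0) (hw : IsRay A w 1) (h23 : z 2 - w 2 = z 3 - w 3)
    (h24 : z 2 - w 2 ≠ z 4 - w 4) : HasPencil A := by
  obtain ⟨x, hx, hx0, hxz⟩ :=
    hz.exists_mem (w 0 + |z 2 - w 2| + |z 4 - w 4|)
  obtain ⟨y, hy, hy1, hyw⟩ :=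
    hw.exists_mem (z 1 + |z 2 - w 2| + |z 4 - w 4|)
  have x1 := hxz 1 (by decide)
  have x2 := hxz 2 (by decide)
  have x3 := hxz 3 (by decide)
  have x4 := hxz 4 (by decide)
  have y0 := hyw 0 (by decide)
  have y2 := hyw 2 (by decide)
  have y3 := hyw 3 (by decide)
  have y4 := hyw 4 (by decide)
  have b2 := abs_le.1 (le_refl |z 2 - w 2|)
  have b4 := abs_le.1 (le_refl |z 4 - w 4|)
  have n2 := abs_nonneg (z 2 - w 2)
  have n4 := abs_nonneg (z 4 - w 4)
  let s : Equiv.Perm (Fin 5) := Equiv.addRight 2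
  refine .of_comp s (hasPencil_of_sub_eq (exists_isRay_comp hA s 0) (mem_tropKernel_comp hx s)
    (mem_tropKernel_comp hy s) (show x 2 - y 2 = x 3 - y 3 by rw [x2, x3, y2, y3, h23])
    (show x 2 - y 2 ≠ x 4 - y 4 by rwa [x2, x4, y2, y4])
    (show x 2 - y 2 ≠ x 0 - y 0 from fun h => ?_) (show x 2 - y 2 ≠ x 1 - y 1 from fun h => ?_)
    (show x 4 - y 4 ≠ x 0 - y 0 from fun h => ?_) (show x 4 - y 4 ≠ x 1 - y 1 from fun h => ?_)
    (show x 0 - y 0 ≠ x 1 - y 1 from fun h => ?_)) <;> linarith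

/-- Two points with infinite coordinates `0` and `1`, respectively, either give rise to a tropical
line or have a constant difference elsewhere. -/
theorem sub_eq_of_not_hasPencil (hA : ∀ k, ∃ z, IsRay A z k) (hno : ¬ HasPencil A)
    {z w : Fin 5 → ℝ} (hz : IsRay A z 0) (hw : IsRay A w 1) :
    z 2 - w 2 = z 3 - w 3 ∧ z 3 - w 3 = z 4 - w 4 := by
  by_contra hc
  by_cases h23 : z 2 - w 2 = z 3 - w 3
  · exact hno (hasPencil_of_two_rays_of_eq hA hz hw h23 fun h => hc ⟨h23, h23.symm.trans h⟩)
  by_cases h24 : z 2 - w 2 = z 4 - w 4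
  · let s : Equiv.Perm (Fin 5) := Equiv.swap 3 4
    exact hno (.of_comp s (hasPencil_of_two_rays_of_eq (exists_isRay_comp hA s)
      (IsRay.comp (k := 0) s hz) (IsRay.comp (k := 1) s hw) h24 h23))
  by_cases h34 : z 3 - w 3 = z 4 - w 4
  · let s : Equiv.Perm (Fin 5) := Equiv.swap 2 4
    exact hno (.of_comp s (hasPencil_of_two_rays_of_eq (exists_isRay_comp hA s)
      (IsRay.comp (k := 0) s hz) (IsRay.comp (k := 1) s hw) h34.symm (Ne.symm h24)))
  refine hno (hasPencil_of_isRay_of_isRay hz hw ?_)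
  rintro i ⟨hi, hi'⟩ j ⟨hj, hj'⟩ hij
  fin_cases i <;> fin_cases j <;> simp at hi hi' hj hj' hij ⊢ <;> grind

/-- Without a pencil, rays at two different indices agree up to a constant at the remaining three.
This rigidity forces all five rays to start at one point, which gives a pencil after all. -/
theorem hasPencil_of_exists_isRay (hA : ∀ k, ∃ z, IsRay A z k) : HasPencil A := by
  by_contra hno
  have key : ∀ (s : Equiv.Perm (Fin 5)) (z w : Fin 5 → ℝ), IsRay A z (s 0) → IsRay A w (s 1) →
      z (s 2) - w (s 2) = z (s 3) - w (s 3) ∧ z (s 3) - w (s 3) = z (s 4) - w (s 4) := by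
    intro s z w hz hw
    exact sub_eq_of_not_hasPencil (exists_isRay_comp hA s) (fun h => hno (.of_comp s h))
      (IsRay.comp (k := 0) s hz) (IsRay.comp (k := 1) s hw)
  obtain ⟨z, hz⟩ := hA 0
  obtain ⟨w, hw⟩ := hA 1
  obtain ⟨d23, d34⟩ := key 1 z w hz hw
  change z 2 - w 2 = z 3 - w 3 at d23
  change z 3 - w 3 = z 4 - w 4 at d34
  obtain ⟨x, hx, hx0, hxz⟩ := hz.exists_mem (w 0 + (z 2 - w 2))
  obtain ⟨y, hy, hy1, hyw⟩ := hw.exists_mem (z 1 - (z 2 - w 2))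
  have x1 := hxz 1 (by decide)
  have x2 := hxz 2 (by decide)
  have x3 := hxz 3 (by decide)
  have x4 := hxz 4 (by decide)
  have y0 := hyw 0 (by decide)
  have y2 := hyw 2 (by decide)
  have y3 := hyw 3 (by decide)
  have y4 := hyw 4 (by decide)
  -- The common point takes coordinate 0 from the translate of `w`, coordinate 1 from `z`, and the
  -- rest from either.
  obtain ⟨v, hv, v0, v1, v2, v3, v4⟩ : ∃ v ∈ tropKernel A, v 0 = w 0 + (z 2 - w 2) ∧
      v 1 = z 1 ∧ v 2 = z 2 ∧ v 3 = z 3 ∧ v 4 = z 4 := by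
    refine ⟨_, min_add_mem_tropKernel hx hy (z 2 - w 2), ?_, ?_, ?_, ?_, ?_⟩
    · rw [y0]; exact min_eq_right (by linarith)
    · rw [x1]; exact min_eq_left (by linarith)
    · rw [x2]; exact min_eq_left (by linarith)
    · rw [x3]; exact min_eq_left (by linarith)
    · rw [x4]; exact min_eq_left (by linarith)
  have r0 : IsRay A v 0 := hz.congr 0 fun i hi => by
    fin_cases i
    · exact absurd rfl hi
    all_goals dsimp; linarith
  have r1 : IsRay A v 1 := hw.congr (z 2 - w 2) fun i hi => by
    fin_cases i
    · dsimp; linarith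
    · exact absurd rfl hi
    all_goals dsimp; linarith
  -- Comparison with the ray at 0 gives agreement off 0 and 2, comparison with the ray at 1 gives it
  -- off 1 and 2. The shared indices 3 and 4 make the constants equal.
  have r2 : IsRay A v 2 := by
    obtain ⟨p, hp⟩ := hA 2
    have h0 := key (Equiv.ofBijective ![2, 0, 1, 3, 4] (by decide)) p v hp r0
    have h1 := key (Equiv.ofBijective ![2, 1, 0, 3, 4] (by decide)) p v hp r1
    change p 1 - v 1 = p 3 - v 3 ∧ p 3 - v 3 = p 4 - v 4 at h0
    change p 0 - v 0 = p 3 - v 3 ∧ p 3 - v 3 = p 4 - v 4 at h1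
    exact hp.congr (v 3 - p 3) fun i hi => by
      fin_cases i <;> first | exact absurd rfl hi | (dsimp; linarith)
  have r3 : IsRay A v 3 := by
    obtain ⟨p, hp⟩ := hA 3
    have h0 := key (Equiv.ofBijective ![3, 0, 1, 2, 4] (by decide)) p v hp r0
    have h1 := key (Equiv.ofBijective ![3, 1, 0, 2, 4] (by decide)) p v hp r1
    change p 1 - v 1 = p 2 - v 2 ∧ p 2 - v 2 = p 4 - v 4 at h0
    change p 0 - v 0 = p 2 - v 2 ∧ p 2 - v 2 = p 4 - v 4 at h1
    exact hp.congr (v 2 - p 2) fun i hi => by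
      fin_cases i <;> first | exact absurd rfl hi | (dsimp; linarith)
  have r4 : IsRay A v 4 := by
    obtain ⟨p, hp⟩ := hA 4
    have h0 := key (Equiv.ofBijective ![4, 0, 1, 2, 3] (by decide)) p v hp r0
    have h1 := key (Equiv.ofBijective ![4, 1, 0, 2, 3] (by decide)) p v hp r1
    change p 1 - v 1 = p 2 - v 2 ∧ p 2 - v 2 = p 3 - v 3 at h0
    change p 0 - v 0 = p 2 - v 2 ∧ p 2 - v 2 = p 3 - v 3 at h1
    exact hp.congr (v 2 - p 2) fun i hi => by
      fin_cases i <;> first | exact absurd rfl hi | (dsimp; linarith)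
  exact hno (hasPencil_of_isRay le_rfl rfl rfl rfl (by simp) (by simp) r0 r1 r2 r3 r4)

end Five

/-! ### Lifting the rows -/

section Lift

variable {ι : Type*} {p q : ι → RealPuiseux} {α : ι → ℝ}

theorem RealPuiseux.ord_det_comm (p q : ι → RealPuiseux) (i j : ι) :
    ord (p i * q j - p j * q i) = ord (p j * q i - p i * q j) := by
  rw [← neg_sub, ord_neg]

variable [Fintype ι]

/-- A linear relation whose coordinates have orders bounded below by `α`, with equality at `i`. -/
theorem exists_relation (hD : ∀ i j, i ≠ j → p i * q j - p j * q i ≠ 0)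
    (hα : ∀ k, AttainedTwiceOff k fun i => ord (p i * q k - p k * q i) + α i) (i : ι) :
    ∃ x : ι → RealPuiseux, ∑ l, x l * p l = 0 ∧ ∑ l, x l * q l = 0 ∧
      (∀ l, ∀ t < α l, (x l : HahnSeries ℝ ℂ).coeff t = 0) ∧
      (x i : HahnSeries ℝ ℂ).coeff (α i) ≠ 0 := by
  classical
  let D : ι → ι → RealPuiseux := fun i j => p i * q j - p j * q i
  have hDc : ∀ i j, ord (D i j) = ord (D j i) := ord_det_comm p q
  -- The relation is supported on `i`, `j`, `k`, with the complementary minors as entries. The pair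
  -- `j`, `k` is chosen to minimize the valuation that bounds the entries at `j` and `k`.
  obtain ⟨⟨j, k⟩, hjk, hmin⟩ := Finset.exists_min_image
    (Finset.univ.filter fun a : ι × ι => a.1 ≠ a.2 ∧ a.1 ≠ i ∧ a.2 ≠ i)
    (fun a => ord (D a.1 a.2) + α a.1 + α a.2) (by
      obtain ⟨a, b, hab, ha, hb, -⟩ := hα i
      exact ⟨(a, b), by simp [hab, ha, hb]⟩)
  simp only [Finset.mem_filter, Finset.mem_univ, true_and] at hjk hmin
  obtain ⟨hjk, hji, hki⟩ := hjk
  have key : ∀ j k, j ≠ k → j ≠ i → k ≠ i →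
      (∀ l, l ≠ k → l ≠ i → ord (D j k) + α j + α k ≤ ord (D l k) + α l + α k) →
      ord (D j k) + α j ≤ ord (D i k) + α i := by
    intro j k hjk hji hki h
    -- Of two indices that attain the minimum off `k`, at least one differs from `i`, and minimality
    -- of the pair applies to it.
    obtain ⟨a, b, hab, ha, hb, hl⟩ := hα k
    have : ∃ l, l ≠ k ∧ l ≠ i ∧ ord (D l k) + α l ≤ ord (D i k) + α i := by
      by_cases hai : a = i
      · exact ⟨b, hb, fun h => hab (hai.trans h.symm), (hl i hki.symm).2⟩
      · exact ⟨a, ha, hai, (hl i hki.symm).1⟩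
    obtain ⟨l, hlk, hli, hle⟩ := this
    linarith [h l hlk hli]
  have h1 := key j k hjk hji hki fun l hlk hli => hmin (l, k) ⟨hlk, hli, hki⟩
  have h2 := key k j hjk.symm hki hji fun l hlj hli => by
    have := hmin (l, j) ⟨hlj, hli, hji⟩
    simp only at this
    rw [hDc k j]
    linarith
  have hm : ∀ s, mono s 1 ≠ 0 := fun s => mono_ne_zero one_ne_zero
  let x : ι → RealPuiseux := fun l => mono (α i - ord (D j k)) 1 *
    (if l = i then D j k else if l = j then D k i else if l = k then D i j else 0)
  have hxi : x i ≠ 0 ∧ ord (x i) = α i := by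
    simp only [x, if_true]
    refine ⟨mul_ne_zero (hm _) (hD j k hjk), ?_⟩
    rw [ord_mul (hm _) (hD j k hjk), ord_mono one_ne_zero]
    ring
  have hsum : ∀ r : ι → RealPuiseux, D j k * r i + D k i * r j + D i j * r k = 0 →
      ∑ l, x l * r l = 0 := by
    intro r hr
    have hx : ∀ l, x l * r l = mono (α i - ord (D j k)) 1 * ((if l = i then D j k * r i else 0) +
        (if l = j then D k i * r j else 0) + (if l = k then D i j * r k else 0)) := by
      intro l
      simp only [x, mul_assoc]
      by_cases hi : l = i
      · subst hi
        simp [hji.symm, hki.symm]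
      · by_cases hj : l = j
        · subst hj
          simp [hi, hjk]
        · by_cases hk : l = k
          · subst hk
            simp [hi, hj]
          · simp [hi, hj, hk]
    simp only [hx, ← Finset.mul_sum, Finset.sum_add_distrib, Finset.sum_ite_eq', Finset.mem_univ,
      if_true, hr, mul_zero]
  have hcoeff : ∀ (y : RealPuiseux) (a : ℝ), a ≤ ord y → ∀ t < a,
      (y : HahnSeries ℝ ℂ).coeff t = 0 := fun y a ha t ht =>
    HahnSeries.coeff_eq_zero_of_lt_order (lt_of_lt_of_le ht ha)
  refine ⟨x, hsum p ?_, hsum q ?_, fun l => ?_, ?_⟩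
  · simp only [D]; ring
  · simp only [D]; ring
  · by_cases hi : l = i
    · subst hi
      exact hcoeff _ _ hxi.2.ge
    · by_cases hj : l = j
      · subst hj
        refine hcoeff _ _ ?_
        simp only [x, hi, if_false, if_true]
        rw [ord_mul (hm _) (hD k i hki), ord_mono one_ne_zero]
        linarith [hDc l k, hDc k i]
      · by_cases hk : l = k
        · subst hk
          refine hcoeff _ _ ?_
          simp only [x, hi, hj, if_false, if_true]
          rw [ord_mul (hm _) (hD i j hji.symm), ord_mono one_ne_zero]
          linarith [hDc l j]
        · simp [x, hi, hj, hk]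
  · have h0 : (x i : HahnSeries ℝ ℂ) ≠ 0 := fun h => hxi.1 (Subtype.ext h)
    have := HahnSeries.coeff_order_eq_zero.not.2 h0
    rwa [show (x i : HahnSeries ℝ ℂ).order = α i from hxi.2] at this

theorem exists_lift_of_attainedTwiceOff (hD : ∀ i j, i ≠ j → p i * q j - p j * q i ≠ 0)
    (hα : ∀ k, AttainedTwiceOff k fun i => ord (p i * q k - p k * q i) + α i) :
    ∃ x : ι → RealPuiseux, ∑ l, x l * p l = 0 ∧ ∑ l, x l * q l = 0 ∧
      ∀ l, x l ≠ 0 ∧ ord (x l) = α l := by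
  choose y hyp hyq hlt hne using exists_relation hD hα
  -- The coefficient at `α l` of a combination is a linear form in `c`, nonzero because the relation
  -- for `l` contributes to it. Finitely many nonzero forms over the infinite field `ℂ` have a
  -- common point of nonvanishing.
  obtain ⟨c, hc⟩ := Module.Dual.exists_forall_ne_zero_of_forall_exists (K := ℂ)
    (fun l => (∑ i, (y i l : HahnSeries ℝ ℂ).coeff (α l) • LinearMap.proj i :
      (ι → ℂ) →ₗ[ℂ] ℂ)) fun l => by
        classical
        exact ⟨Pi.single l 1, by simpa [Pi.single_apply] using hne l⟩
  have hcoeff : ∀ l t, ((∑ i, mono 0 (c i) * y i l : RealPuiseux) : HahnSeries ℝ ℂ).coeff t =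
      ∑ i, (y i l : HahnSeries ℝ ℂ).coeff t * c i := by
    intro l t
    push_cast
    rw [HahnSeries.coeff_sum]
    exact Finset.sum_congr rfl fun i _ => by
      rw [coe_mono, HahnSeries.coeff_single_zero_mul, mul_comm]
  have hrel : ∀ r : ι → RealPuiseux, (∀ i, ∑ l, y i l * r l = 0) →
      ∑ l, (∑ i, mono 0 (c i) * y i l) * r l = 0 := by
    intro r hr
    simp only [Finset.sum_mul]
    rw [Finset.sum_comm]
    exact Finset.sum_eq_zero fun i _ => by
      simp only [mul_assoc, ← Finset.mul_sum, hr i, mul_zero]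
  refine ⟨fun l => ∑ i, mono 0 (c i) * y i l, hrel p hyp, hrel q hyq, fun l => ?_⟩
  refine ord_eq_of_coeff ?_ fun t ht => ?_
  · rw [hcoeff]
    simpa using hc l
  · rw [hcoeff]
    exact Finset.sum_eq_zero fun i _ => by rw [hlt i l t ht, zero_mul]

/-- A matrix with a pencil of relations has a lift of corank at least two. -/
theorem HasPencil.exists_lift {ρ : Type*} {A : ρ → ι → ℝ} [Nontrivial ι] (hA : HasPencil A) :
    ∃ B : Matrix ρ ι RealPuiseux, (∀ r i, B r i ≠ 0 ∧ ord (B r i) = A r i) ∧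
      2 ≤ Module.finrank RealPuiseux (LinearMap.ker B.mulVecLin) := by
  obtain ⟨p, q, hD, hk⟩ := hA
  choose B hp hq hB using fun r => exists_lift_of_attainedTwiceOff hD fun k => hk k r
  refine ⟨Matrix.of B, hB, ?_⟩
  have hpm : p ∈ LinearMap.ker (Matrix.of B).mulVecLin := by
    exact LinearMap.mem_ker.2 (funext hp)
  have hqm : q ∈ LinearMap.ker (Matrix.of B).mulVecLin := by
    exact LinearMap.mem_ker.2 (funext hq)
  have hli : LinearIndependent RealPuiseux
      (![⟨p, hpm⟩, ⟨q, hqm⟩] : Fin 2 → LinearMap.ker (Matrix.of B).mulVecLin) := by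
    rw [LinearIndependent.pair_iff]
    intro s t hst
    obtain ⟨i, j, hij⟩ := exists_pair_ne ι
    have hst' : s • p + t • q = 0 := congrArg Subtype.val hst
    have hi := congrFun hst' i
    have hj := congrFun hst' j
    simp only [Pi.add_apply, Pi.smul_apply, smul_eq_mul, Pi.zero_apply] at hi hj
    have hs : s * (p i * q j - p j * q i) = 0 := by linear_combination q j * hi - q i * hj
    have ht : t * (p i * q j - p j * q i) = 0 := by linear_combination p i * hj - p j * hi
    exact ⟨(mul_eq_zero.1 hs).resolve_right (hD i j hij),
      (mul_eq_zero.1 ht).resolve_right (hD i j hij)⟩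
  simpa using hli.fintype_card_le_finrank

end Lift

/-! ### Linear ideals and nonsingular lifts -/

section LinearSpace

/-- Every linear subspace is the zero set of a linear ideal. -/
theorem exists_isLinearIdeal {d : ℕ} (W : Submodule RealPuiseux (Fin d → RealPuiseux)) :
    ∃ I : Ideal (MvPolynomial (Fin d) RealPuiseux), IsLinearIdeal I ∧ affineZeros I = W := by
  let F : (Fin d → RealPuiseux) → MvPolynomial (Fin d) RealPuiseux := fun c =>
    ∑ i, MvPolynomial.C (c i) * MvPolynomial.X i
  have hF : ∀ c x, MvPolynomial.eval x (F c) = ∑ i, c i * x i := by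
    intro c x
    simp [F]
  let S : Set (MvPolynomial (Fin d) RealPuiseux) := F '' {c | ∀ w ∈ W, ∑ i, c i * w i = 0}
  refine ⟨Ideal.span S, ⟨S, ?_, rfl⟩, ?_⟩
  · rintro _ ⟨c, -, rfl⟩
    exact MvPolynomial.IsHomogeneous.sum _ _ _ fun i _ => MvPolynomial.isHomogeneous_C_mul_X _ _
  · ext x
    constructor
    · intro hx
      by_contra hxW
      obtain ⟨φ, hφ, hle⟩ := Submodule.exists_le_ker_of_notMem hxW
      have hsum : ∀ y, φ y = ∑ i, φ (Pi.single i 1) * y i := by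
        intro y
        conv_lhs => rw [pi_eq_sum_univ' y]
        simp [map_sum, mul_comm]
      refine hφ ?_
      have := hx (F fun i => φ (Pi.single i 1)) (Ideal.subset_span ⟨_, fun w hw => ?_, rfl⟩)
      · rwa [hF, ← hsum] at this
      · rw [← hsum]
        exact hle hw
    · intro hx
      have hle : Ideal.span S ≤ RingHom.ker (MvPolynomial.eval x) := by
        rw [Ideal.span_le]
        rintro _ ⟨c, hc, rfl⟩
        simpa [RingHom.mem_ker, hF] using hc x hx
      exact fun f hf => hle hf

theorem RealPuiseux.ord_prod {κ : Type*} (s : Finset κ) (x : κ → RealPuiseux)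
    (hx : ∀ i ∈ s, x i ≠ 0) : ord (∏ i ∈ s, x i) = ∑ i ∈ s, ord (x i) := by
  classical
  induction s using Finset.induction_on with
  | empty => exact HahnSeries.order_one
  | insert a s ha ih =>
    rw [Finset.prod_insert ha, Finset.sum_insert ha,
      ord_mul (hx a (Finset.mem_insert_self _ _))
        (Finset.prod_ne_zero_iff.2 fun i hi => hx i (Finset.mem_insert_of_mem hi)),
      ih fun i hi => hx i (Finset.mem_insert_of_mem hi)]

/-- A lift of a tropically nonsingular matrix is nonsingular. -/
theorem det_ne_zero_of_not_tropSingular {r : ℕ} {M : Matrix (Fin r) (Fin r) ℝ}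
    (hM : ¬ TropSingular M) {B : Matrix (Fin r) (Fin r) RealPuiseux}
    (hB : ∀ i j, B i j ≠ 0 ∧ ord (B i j) = M i j) : B.det ≠ 0 := by
  have hord : ∀ σ : Equiv.Perm (Fin r), ord (∏ i, B i (σ i)) = tropWeight M σ := fun σ => by
    rw [ord_prod _ _ fun i _ => (hB i _).1]
    exact Finset.sum_congr rfl fun i _ => (hB i _).2
  obtain ⟨σ, -, hσ⟩ := Finset.exists_mem_eq_inf' Finset.univ_nonempty (tropWeight M)
  -- Only `σ` attains the minimum, so its term alone contributes to the coefficient of the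
  -- determinant at `tropDet M`.
  have hlt : ∀ τ, τ ≠ σ → tropDet M < tropWeight M τ := by
    intro τ hτ
    refine (Finset.inf'_le (tropWeight M) (Finset.mem_univ τ)).lt_of_ne fun h => ?_
    exact hM ⟨τ, σ, hτ, h.symm, hσ.symm⟩
  have hcoeff : ((∏ i, B i (σ i) : RealPuiseux) : HahnSeries ℝ ℂ).coeff (tropDet M) ≠ 0 := by
    have h0 : ((∏ i, B i (σ i) : RealPuiseux) : HahnSeries ℝ ℂ) ≠ 0 := fun h =>
      Finset.prod_ne_zero_iff.2 (fun i _ => (hB i (σ i)).1) (Subtype.ext h)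
    have := HahnSeries.coeff_order_eq_zero.not.2 h0
    have h1 : ((∏ i, B i (σ i) : RealPuiseux) : HahnSeries ℝ ℂ).order = tropDet M :=
      (hord σ).trans hσ.symm
    rwa [h1] at this
  intro hdet
  have h : ((B.det : RealPuiseux) : HahnSeries ℝ ℂ).coeff (tropDet M) = 0 := by
    rw [hdet]
    simp
  rw [← Matrix.det_transpose, Matrix.det_apply] at h
  simp only [Matrix.transpose_apply] at h
  push_cast at h
  rw [HahnSeries.coeff_sum, Finset.sum_eq_single σ] at h
  · rcases Int.units_eq_one_or (Equiv.Perm.sign σ) with hs | hs <;> simp [hs] at h <;>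
      exact hcoeff (by simpa using h)
  · intro τ _ hτ
    have : ((∏ i, B i (τ i) : RealPuiseux) : HahnSeries ℝ ℂ).coeff (tropDet M) = 0 :=
      HahnSeries.coeff_eq_zero_of_lt_order ((hlt τ hτ).trans_eq (hord τ).symm)
    rcases Int.units_eq_one_or (Equiv.Perm.sign τ) with hs | hs <;> simpa [hs] using this
  · simp

end LinearSpace

/-! ### Comparison of the ranks -/

section Rank

variable {g n : ℕ} {A : Matrix (Fin g) (Fin n) ℝ}

theorem bddAbove_nonsingular_minors (A : Matrix (Fin g) (Fin n) ℝ) :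
    BddAbove {r : ℕ | ∃ (f : Fin r ↪ Fin g) (e : Fin r ↪ Fin n),
      ¬ TropSingular (A.submatrix f e)} :=
  ⟨g, fun r ⟨f, _⟩ => by simpa using Fintype.card_le_of_embedding f⟩

theorem exists_nonsingular_minor :
    ∃ (f : Fin (tropicalRank A) ↪ Fin g) (e : Fin (tropicalRank A) ↪ Fin n),
      ¬ TropSingular (A.submatrix f e) := by
  refine Nat.sSup_mem (s := {r : ℕ | ∃ (f : Fin r ↪ Fin g) (e : Fin r ↪ Fin n),
    ¬ TropSingular (A.submatrix f e)}) ⟨0, ⟨Fin.elim0, fun a => a.elim0⟩,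
      ⟨Fin.elim0, fun a => a.elim0⟩, ?_⟩ (bddAbove_nonsingular_minors A)
  rintro ⟨σ, τ, hne, -⟩
  exact hne (Subsingleton.elim _ _)

theorem tropSingular_of_tropicalRank_lt {r : ℕ} (hr : tropicalRank A < r) (f : Fin r ↪ Fin g)
    (e : Fin r ↪ Fin n) : TropSingular (A.submatrix f e) := by
  by_contra h
  exact absurd (le_csSup (bddAbove_nonsingular_minors A) ⟨f, e, h⟩) (not_le.2 hr)

/-- The tropical rank is a lower bound for the dimension of a space containing a lift. -/
theorem tropicalRank_le_finrank {B : Matrix (Fin g) (Fin n) RealPuiseux}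
    (hB : ∀ i j, B i j ≠ 0 ∧ ord (B i j) = A i j)
    {W : Submodule RealPuiseux (Fin g → RealPuiseux)} (hW : ∀ j, B.col j ∈ W) :
    tropicalRank A ≤ Module.finrank RealPuiseux W := by
  obtain ⟨f, e, hfe⟩ := exists_nonsingular_minor (A := A)
  have hdet := det_ne_zero_of_not_tropSingular hfe (B := B.submatrix f e) fun i j => hB _ _
  have hli : LinearIndependent RealPuiseux fun i => (B.submatrix f e).col i :=
    Matrix.linearIndependent_cols_of_det_ne_zero hdet
  have hli' : LinearIndependent RealPuiseux
      fun i => (⟨B.col (e i), hW (e i)⟩ : W) := by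
    apply LinearIndependent.of_comp
      ((LinearMap.funLeft RealPuiseux RealPuiseux f).comp W.subtype)
    exact hli
  simpa using hli'.fintype_card_le_finrank

theorem tropicalRank_le_of_isTropicalLinearSpace {r : ℕ} {T : Set (Fin g → ℝ)}
    (hT : IsTropicalLinearSpace r T) (hA : ∀ j, (fun i => A i j) ∈ T) : tropicalRank A ≤ r := by
  obtain ⟨I, -, rfl, rfl⟩ := hT
  choose x hx hxA using hA
  exact tropicalRank_le_finrank (B := fun i j => x j i)
    (fun i j => ⟨(hx j).2 i, congrFun (hxA j) i⟩) fun j => Submodule.subset_span (hx j).1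

end Rank

theorem mainTheorem1 (g : ℕ) (A : Matrix (Fin g) (Fin 5) ℝ) (hA : tropicalRank A = 3) :
    kapranovRank A = 3 := by
  obtain ⟨B, hB, hker⟩ := (hasPencil_of_exists_isRay
    (exists_isRay (A := A) (tropSingular_of_tropicalRank_lt (by omega)))).exists_lift
  have hcol : ∀ j, B.col j ∈ LinearMap.range B.mulVecLin := fun j =>
    ⟨Pi.single j 1, by simp⟩
  -- Corank at least two bounds the rank of the lift by three; its tropical rank gives the opposite
  -- bound.
  have hrank : Module.finrank RealPuiseux (LinearMap.range B.mulVecLin) = 3 := by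
    have h1 := LinearMap.finrank_range_add_finrank_ker B.mulVecLin
    have h2 := tropicalRank_le_finrank hB hcol
    simp only [Module.finrank_fin_fun] at h1
    omega
  obtain ⟨I, hI, hIW⟩ := exists_isLinearIdeal (LinearMap.range B.mulVecLin)
  have hmem : 3 ∈ {r : ℕ | ∃ T : Set (Fin g → ℝ), IsTropicalLinearSpace r T ∧
      ∀ j, (fun i => A i j) ∈ T} := by
    refine ⟨_, ⟨I, hI, ?_, rfl⟩, fun j => ⟨B.col j, ⟨?_, fun i => (hB i j).1⟩,
      funext fun i => (hB i j).2⟩⟩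
    · rw [hIW, Set.finrank, Submodule.span_eq, hrank]
    · rw [hIW]
      exact hcol j
  refine le_antisymm (Nat.sInf_le hmem) (le_csInf ⟨3, hmem⟩ ?_)
  rintro r ⟨T, hT, hAT⟩
  exact hA.symm.le.trans (tropicalRank_le_of_isTropicalLinearSpace hT hAT)
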